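/- Let $n\ge 3$ and let $\mu$ be a compactly supported finite signed Borel measure on $\mathbb R^n$ that is $\alpha$-dimensional for some real $\alpha>n-2$: there is a constant $C$ such that $|\mu|(B(x,r))\le C r^{\alpha}$ for all $x\in\mathbb R^n$ and $r>0$. Let $H^1(\mathbb R^n)$ be the Sobolev space of $u\in L^2(\mathbb R^n)$ with distributional gradient in $L^2$. Call $f\in L^2(|\mu|)$ a trace of $u\in H^1(\mathbb R^n)$ if there are Schwartz functions $\varphi_k$ with $\varphi_k\to u$ in $H^1(\mathbb R^n)$ and $\varphi_k\to f$ in $L^2(|\mu|)$. Then the following hold. (1) Every $u\in H^1(\mathbb R^n)$ has exactly one trace; it is denoted $u|_\mu$. (2) $\mu$ is form-bounded relative to $-\Delta$ with arbitrarily small relative bound: for every $a>0$ there is $b\in\mathbb R$ such that, for all $u\in H^1(\mathbb R^n)$, $$\Big|\int_{\mathbb R^n} |u|_\mu|^2\,d\mu\Big|\le a\,\|\nabla u\|_{L^2}^2+b\,\|u\|_{L^2}^2 .$$ (3) $-\Delta+\mu$ has a unique self-adjoint extension. Precisely, let $-\Delta+\mu$ be the operator in $L^2(\mathbb R^n)$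 with domain $\{u\in H^1(\mathbb R^n): -\Delta u+u|_\mu\,\mu\in L^2(\mathbb R^n)\}$, acting in the sense of distributions, and let $$q(v,u)=\int_{\mathbb R^n}\overline{\nabla v}\cdot\nabla u\,dx+\int_{\mathbb R^n}\overline{v|_\mu}\,u|_\mu\,d\mu ,\qquad u,v\in H^1(\mathbb R^n).$$ There is a self-adjoint operator $H$ in $L^2(\mathbb R^n)$ such that - $H$ extends $-\Delta+\mu$, and $Hu=-\Delta u+u|_\mu\,\mu$ (with $u \in H^1(\mathbb R^n)$) for all $u$ in the domain of $H$; - $H$ is bounded from below, its form domain is $H^1(\mathbb R^n)$, and $\langle v,Hu\rangle=q(v,u)$ for all $u$ in the domain of $H$ and all $v\in H^1(\mathbb R^n)$; - every self-adjoint operator in $L^2(\mathbb R^n)$ that extends $-\Delta+\mu$ equals $H$; - every self-adjoint operator $H'$ in $L^2(\mathbb R^n)$ whose domain is contained in $H^1(\mathbb R^n)$ and which satisfies $\langle v,H'u\rangle=q(v,u)$ for all $u$ in its domain and all $v\in H^1(\mathbb R^n)$ equals $H$. Here the form domain of $H$ is the set of $L^2$-limits of sequences $(u_k)$ in the domain of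 $H$ with $\langle u_k-u_m,H(u_k-u_m)\rangle\to0$ as $k,m\to\infty$. -/

import Mathlib

open MeasureTheory Filter Topology
open scoped SchwartzMap LineDeriv Laplacian

noncomputable section

namespace MeasureSchrodinger

/-- The Euclidean space `ℝⁿ`. -/
abbrev Space (n : ℕ) : Type := EuclideanSpace ℝ (Fin n)

/-- The complex Hilbert space `L²(ℝⁿ)` (Lebesgue measure). -/
abbrev L2 (n : ℕ) : Type := Lp ℂ 2 (volume : Measure (Space n))

/-- The `i`-th standard basis vector of `ℝⁿ`. -/
def basisVec {n : ℕ} (i : Fin n) : Space n := EuclideanSpace.single i 1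

/-! ### Compactly supported signed measures of a given dimension -/

/-- The signed measure `μ` is carried by a compact set. -/
def CompactlySupported {n : ℕ} (μ : SignedMeasure (Space n)) : Prop :=
  ∃ K : Set (Space n), IsCompact K ∧ μ.totalVariation Kᶜ = 0

/-- `μ` is `α`-dimensional: `|μ|(B(x, r)) ≤ C r ^ α` for all `x` and all `r > 0`. -/
def IsDimensional {n : ℕ} (α : ℝ) (μ : SignedMeasure (Space n)) : Prop :=
  ∃ C : ℝ, ∀ (x : Space n) (r : ℝ), 0 < r →
    μ.totalVariation (Metric.ball x r) ≤ ENNReal.ofReal (C * r ^ α)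

/-- The integral `∫ f dμ = ∫ f dμ⁺ - ∫ f dμ⁻` against a signed measure. -/
def signedIntegral {n : ℕ} (μ : SignedMeasure (Space n)) (f : Space n → ℂ) : ℂ :=
  (∫ x, f x ∂μ.toJordanDecomposition.posPart) - ∫ x, f x ∂μ.toJordanDecomposition.negPart

/-! ### The Sobolev space `H¹` and the trace of its elements on `μ` -/

/-- The Sobolev space `H¹(ℝⁿ)`, as a subspace of `L²(ℝⁿ)`. -/
def H1 (n : ℕ) : Submodule ℂ (L2 n) where
  carrier := {u | TemperedDistribution.MemSobolev 1 2 (u : 𝓢'(Space n, ℂ))}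
  zero_mem' := by
    have h := TemperedDistribution.memSobolev_fun_zero (Space n) ℂ 1 2
    rwa [← map_zero (Lp.toTemperedDistributionCLM ℂ (volume : Measure (Space n)) 2)] at h
  add_mem' := by
    intro u v hu hv
    have h := hu.add hv
    rwa [← Lp.toTemperedDistributionCLM_apply, ← Lp.toTemperedDistributionCLM_apply,
      ← map_add] at h
  smul_mem' := by
    intro c u hu
    have h := hu.smul c
    rwa [← Lp.toTemperedDistributionCLM_apply, ← map_smul] at h

theorem exists_weakPartial {n : ℕ} (i : Fin n) (u : H1 n) :
    ∃ g : L2 n, (g : 𝓢'(Space n, ℂ)) = ∂_{basisVec i} ((u : L2 n) : 𝓢'(Space n, ℂ)) := by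
  have hu : TemperedDistribution.MemSobolev 1 2 ((u : L2 n) : 𝓢'(Space n, ℂ)) := u.2
  have h := hu.lineDerivOp (m := basisVec i)
  rw [sub_self, TemperedDistribution.memSobolev_zero_iff] at h
  obtain ⟨g, hg⟩ := h
  exact ⟨g, hg.symm⟩

/-- The distributional partial derivative `∂ᵢ u ∈ L²(ℝⁿ)` of `u ∈ H¹(ℝⁿ)`. -/
def weakPartial {n : ℕ} (i : Fin n) (u : H1 n) : L2 n := (exists_weakPartial i u).choose

/-- The form `∫ conj (∇u) · ∇v` of `-Δ`. -/
def dirichletForm {n : ℕ} (u v : H1 n) : ℂ :=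
  ∑ i, inner ℂ (weakPartial i u) (weakPartial i v)

/-- `f ∈ L²(|μ|)` is a trace of `u ∈ H¹` on `μ`: it is the `L²(|μ|)`-limit of the restrictions of
Schwartz functions that converge to `u` in `H¹`. -/
def IsTrace {n : ℕ} (μ : SignedMeasure (Space n)) (u : H1 n) (f : Lp ℂ 2 μ.totalVariation) :
    Prop :=
  ∃ φ : ℕ → 𝓢(Space n, ℂ),
    Tendsto (fun k => (φ k).toLp 2 volume) atTop (𝓝 (u : L2 n)) ∧
    (∀ i, Tendsto (fun k => (∂_{basisVec i} (φ k)).toLp 2 volume) atTop (𝓝 (weakPartial i u))) ∧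
    Tendsto (fun k => (φ k).toLp 2 μ.totalVariation) atTop (𝓝 f)

open Classical in
/-- The trace of `u ∈ H¹` on `μ` (zero by convention if there is none). -/
def trace {n : ℕ} (μ : SignedMeasure (Space n)) (u : H1 n) : Lp ℂ 2 μ.totalVariation :=
  if h : ∃ f, IsTrace μ u f then h.choose else 0

/-- The form `∫ conj u · v dμ` of multiplication by `μ`. -/
def measureForm {n : ℕ} (μ : SignedMeasure (Space n)) (u v : H1 n) : ℂ :=
  signedIntegral μ fun x => star (trace μ u x) * trace μ v x

/-- The form of `-Δ + μ`, with form domain `H¹`. -/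
def schrodingerForm {n : ℕ} (μ : SignedMeasure (Space n)) (u v : H1 n) : ℂ :=
  dirichletForm u v + measureForm μ u v

/-! ### The operator `-Δ + μ` and operators associated with its form -/

/-- `u ∈ H¹`, `f ∈ L²`, and `-Δu + μu = f` as tempered distributions: `(u, f)` is in the graph of
the operator `-Δ + μ` acting in the sense of distributions. -/
def ActsTo {n : ℕ} (μ : SignedMeasure (Space n)) (u f : L2 n) : Prop :=
  ∃ hu : u ∈ H1 n, ∀ φ : 𝓢(Space n, ℂ),
    (f : 𝓢'(Space n, ℂ)) φ =
      -(Δ (u : 𝓢'(Space n, ℂ))) φ + signedIntegral μ fun x => φ x * trace μ ⟨u, hu⟩ x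

/-- The operator `H` extends `-Δ + μ`. -/
def Extends {n : ℕ} (μ : SignedMeasure (Space n)) (H : L2 n →ₗ.[ℂ] L2 n) : Prop :=
  ∀ u f, ActsTo μ u f → (u, f) ∈ H.graph

/-- The operator `H` is associated with the form `q` of `-Δ + μ`: its domain lies in `H¹`, and
`⟨v, H u⟩ = q(v, u)` for all `u` in the domain of `H` and all `v ∈ H¹`. -/
def IsAssociated {n : ℕ} (μ : SignedMeasure (Space n)) (H : L2 n →ₗ.[ℂ] L2 n) : Prop :=
  ∀ u : H.domain, ∃ hu : (u : L2 n) ∈ H1 n,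
    ∀ v : H1 n, inner ℂ (v : L2 n) (H u) = schrodingerForm μ v ⟨u, hu⟩

/-- `H` is bounded from below. -/
def IsBoundedBelow {E : Type*} [NormedAddCommGroup E] [InnerProductSpace ℂ E]
    (H : E →ₗ.[ℂ] E) : Prop :=
  ∃ c : ℝ, ∀ u : H.domain, c * ‖(u : E)‖ ^ 2 ≤ (inner ℂ (u : E) (H u)).re

/-- The form domain of a symmetric operator `H` that is bounded from below: all limits of sequences
in the domain of `H` that are Cauchy for the form `⟨u, H u⟩`. -/
def formDomain {E : Type*} [NormedAddCommGroup E] [InnerProductSpace ℂ E]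
    (H : E →ₗ.[ℂ] E) : Set E :=
  {u | ∃ x : ℕ → H.domain, Tendsto (fun k => (x k : E)) atTop (𝓝 u) ∧
    Tendsto (fun p : ℕ × ℕ => inner ℂ ((x p.1 - x p.2 : H.domain) : E) (H (x p.1 - x p.2)))
      atTop (𝓝 0)}

end MeasureSchrodinger

end

/-! Everything rests on a trace inequality for `|μ|` on Schwartz functions. Put `α = n - 2 + 2δ`
with `δ > 0`, and write `φ(x) = φ(x + h) - ∫₀¹ ∇φ(x + th)·h dt`. Square, average over `|h| < ε`, and
integrate in `x` against `|μ|`. A ball of radius `tε` has mass at most `C(tε)^α`, so by Tonelli the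
gradient term is controlled by `ε² ε^α / ε^n = ε^(2δ)` times `‖∇φ‖²`. This tends to `0` with `ε`,
which gives relative bound zero (`lintegral_enorm_sq_le`, `exists_norm_toLp_sq_le`). Existence,
uniqueness and bounds for the trace on `H¹` follow by density of Schwartz functions.

For the operator, a Bessel potential `J` identifies `H¹` with `L²` (`exists_besselPotential`). The
form, shifted by a multiple of the `L²` inner product, becomes `⟨g', B g⟩` with `B` bounded,
self-adjoint and coercive. The operator `R = J B⁻¹ J*` is then injective and self-adjoint, and `R⁻¹`
minus the shift is the required `H` (`exists_isSelfAdjoint_of_form`).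

By density again, the distributional equation `-Δu + μu = f` is equivalent to the form identity
tested on all of `H¹` (`actsTo_iff`). Hence the graph of `H` is exactly that of `-Δ + μ`, and both
uniqueness claims reduce to the maximality of self-adjoint operators (`eq_of_isSelfAdjoint_of_le`).
-/

namespace MeasureSchrodinger

/-! ### Self-adjoint operators from coercive forms on a Hilbert space -/

section FormOperator

variable {E : Type*} [NormedAddCommGroup E] [InnerProductSpace ℂ E] [CompleteSpace E]

theorem denseRange_of_inner_eq_zero {T : E →L[ℂ] E}
    (h : ∀ x, (∀ v, inner ℂ (T v) x = 0) → x = 0) : DenseRange T := by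
  have h1 : (LinearMap.range (T : E →ₗ[ℂ] E))ᗮ = ⊥ := by
    rw [Submodule.eq_bot_iff]
    exact fun x hx => h x fun v => (Submodule.mem_orthogonal _ _).1 hx _ ⟨v, rfl⟩
  have h2 := Submodule.topologicalClosure_eq_top_iff.2 h1
  have h3 : ((LinearMap.range (T : E →ₗ[ℂ] E) : Submodule ℂ E) : Set E) = Set.range T :=
    LinearMap.coe_range _
  intro x
  rw [← h3, ← Submodule.topologicalClosure_coe, h2]
  trivial

open ContinuousLinearMap in
/-- An injective bounded self-adjoint operator has dense range. -/
theorem denseRange_of_isSelfAdjoint_of_injective {R : E →L[ℂ] E} (hR : IsSelfAdjoint R)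
    (hinj : Function.Injective R) : DenseRange R := by
  refine denseRange_of_inner_eq_zero fun x hx => hinj ?_
  rw [map_zero]
  refine ext_inner_left ℂ fun v => ?_
  rw [inner_zero_right, ← hR.adjoint_eq, adjoint_inner_right, hx]

/-- A self-adjoint operator is maximal among the symmetric ones. -/
theorem eq_of_isSelfAdjoint_of_le {A B : E →ₗ.[ℂ] E} (hA : IsSelfAdjoint A) (hB : IsSelfAdjoint B)
    (h : A ≤ B) : B = A := by
  refine le_antisymm ?_ h
  -- `B = B*` extends `A`, so `B` lies below `A* = A`.
  have hBA : A.IsFormalAdjoint B := by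
    intro x y
    have h1 := LinearPMap.adjoint_isFormalAdjoint hB.dense_domain
    rw [LinearPMap.isSelfAdjoint_def.1 hB] at h1
    have h2 := h1 ⟨x, h.1 x.2⟩ y
    rwa [← h.2 (x := x) (y := ⟨x, h.1 x.2⟩) rfl] at h2
  have := hBA.le_adjoint hA.dense_domain
  rwa [LinearPMap.isSelfAdjoint_def.1 hA] at this

/-- The inverse of an injective bounded self-adjoint operator, shifted by a real number, is
self-adjoint. -/
theorem exists_isSelfAdjoint_of_resolvent {R : E →L[ℂ] E} (hR : IsSelfAdjoint R)
    (hinj : Function.Injective R) (b : ℝ) :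
    ∃ H : E →ₗ.[ℂ] E, IsSelfAdjoint H ∧
      ∀ u f, (u, f) ∈ H.graph ↔ R (f + (b : ℂ) • u) = u := by
  let e := LinearEquiv.ofInjective (R : E →ₗ[ℂ] E) hinj
  let H : E →ₗ.[ℂ] E := ⟨LinearMap.range (R : E →ₗ[ℂ] E),
    (e.symm : _ →ₗ[ℂ] E) - (b : ℂ) • Submodule.subtype _⟩
  have hH : ∀ x : H.domain, R (H x + (b : ℂ) • (x : E)) = x := by
    intro x
    have h1 : H x = e.symm x - (b : ℂ) • (x : E) := rfl
    rw [h1, sub_add_cancel]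
    exact congrArg Subtype.val (e.apply_symm_apply x)
  have hsymm : ∀ x y, inner ℂ (R x) y = inner ℂ x (R y) := fun x y => by
    rw [← ContinuousLinearMap.adjoint_inner_right, hR.adjoint_eq]
  have hdense : Dense (H.domain : Set E) := by
    have := denseRange_of_isSelfAdjoint_of_injective hR hinj
    rw [DenseRange, ← ContinuousLinearMap.coe_coe, ← LinearMap.coe_range] at this
    exact this
  have hformal : H.IsFormalAdjoint H := by
    intro x y
    have hx := hH x
    have hy := hH y
    have h := hsymm (H x + (b : ℂ) • (x : E)) (H y + (b : ℂ) • (y : E))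
    rw [hx, hy, inner_add_left, inner_add_right, inner_smul_left, inner_smul_right,
      Complex.conj_ofReal] at h
    exact (add_right_cancel h).symm
  have hle : H ≤ H.adjoint := hformal.le_adjoint hdense
  -- For `y` in the domain of `H*`, pairing with `R f`, where `(H + b) R f = f`, gives `y = R (H* y
  -- + b y)`, which lies in the range of `R`.
  have hge : H.adjoint.domain ≤ H.domain := by
    intro y hy
    have hadj := LinearPMap.adjoint_isFormalAdjoint hdense
    set w := H.adjoint ⟨y, hy⟩ with hw
    refine ⟨w + (b : ℂ) • y, ?_⟩
    refine ext_inner_right ℂ fun f => ?_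
    have hmem : R f ∈ H.domain := ⟨f, rfl⟩
    have h1 : inner ℂ w (R f) = inner ℂ y (H ⟨R f, hmem⟩) := hadj ⟨y, hy⟩ ⟨R f, hmem⟩
    have h2 : H ⟨R f, hmem⟩ = f - (b : ℂ) • R f := by
      have := hinj (hH ⟨R f, hmem⟩)
      exact eq_sub_of_add_eq this
    change inner ℂ (R (w + (b : ℂ) • y)) f = inner ℂ y f
    rw [hsymm, inner_add_left, h1, h2, inner_sub_right, inner_smul_left, inner_smul_right,
      Complex.conj_ofReal, sub_add_cancel]
  refine ⟨H, (LinearPMap.eq_of_le_of_domain_eq hle (le_antisymm hle.1 hge)).symm, fun u f => ?_⟩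
  rw [LinearPMap.mem_graph_iff]
  constructor
  · rintro ⟨x, rfl, rfl⟩
    exact hH x
  · intro h
    refine ⟨⟨u, ⟨_, h⟩⟩, rfl, ?_⟩
    have := hinj ((hH ⟨u, ⟨_, h⟩⟩).trans h.symm)
    exact add_right_cancel this

/-- The self-adjoint operator of a closed semibounded form, where the form domain is presented as
the range of the injective bounded operator `J`. -/
theorem exists_isSelfAdjoint_of_form {J B : E →L[ℂ] E} (hJ : Function.Injective J)
    (hJd : DenseRange J) (hB : IsSelfAdjoint B) {c : ℝ} (hc : 0 < c)
    (hcoer : ∀ g, c * ‖g‖ ^ 2 ≤ (inner ℂ g (B g)).re) (b : ℝ) :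
    ∃ H : E →ₗ.[ℂ] E, IsSelfAdjoint H ∧
      (∀ u f, (u, f) ∈ H.graph ↔
        ∃ g, J g = u ∧ ∀ g', inner ℂ g' (B g) = inner ℂ (J g') (f + (b : ℂ) • u)) ∧
      IsBoundedBelow H ∧ formDomain H = Set.range J := by
  -- Lax–Milgram: coercivity makes `B` invertible.
  have hunit : IsUnit B := by
    refine ContinuousLinearMap.isUnit_of_forall_le_norm_inner_map B (c := ⟨c, hc.le⟩) hc fun x => ?_
    rw [norm_inner_symm, mul_comm]
    exact (hcoer x).trans (Complex.re_le_norm _)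
  obtain ⟨C, hBC, hCB⟩ := isUnit_iff_exists.1 hunit
  have hBC' : ∀ x, B (C x) = x := fun x => congrArg (fun T : E →L[ℂ] E => T x) hBC
  have hCB' : ∀ x, C (B x) = x := fun x => congrArg (fun T : E →L[ℂ] E => T x) hCB
  have hBs : ∀ x y, inner ℂ (B x) y = inner ℂ x (B y) := fun x y => by
    rw [← ContinuousLinearMap.adjoint_inner_right, hB.adjoint_eq]
  have hCs : ∀ x y, inner ℂ (C x) y = inner ℂ x (C y) := fun x y => by
    rw [← hBC' y, hCB', ← hBs, hBC']
  set Jt := ContinuousLinearMap.adjoint J with hJt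
  have hJt_inj : Function.Injective Jt := by
    intro x y hxy
    have h : (fun v => inner ℂ v x) = fun v => inner ℂ v y := by
      refine hJd.equalizer (by fun_prop) (by fun_prop) ?_
      funext v
      simp only [Function.comp]
      rw [← ContinuousLinearMap.adjoint_inner_right, ← ContinuousLinearMap.adjoint_inner_right,
        ← hJt, hxy]
    exact ext_inner_left ℂ fun v => congrFun h v
  have hJt_dense : DenseRange Jt := by
    refine denseRange_of_inner_eq_zero fun x hx => hJ ?_
    rw [map_zero]
    refine ext_inner_left ℂ fun v => ?_
    rw [inner_zero_right, ← ContinuousLinearMap.adjoint_inner_left, ← hJt, hx]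
  -- The weak equation `⟨g', B g⟩ = ⟨J g', h⟩` for all `g'` says `B g = J* h`, so its solution is `u
  -- = J g = J B⁻¹ J* h`: this is the resolvent `(H + b)⁻¹`.
  let R : E →L[ℂ] E := J ∘L C ∘L Jt
  have hRs : IsSelfAdjoint R := by
    rw [ContinuousLinearMap.isSelfAdjoint_iff_isSymmetric]
    intro x y
    change inner ℂ (J (C (Jt x))) y = inner ℂ x (J (C (Jt y)))
    rw [← ContinuousLinearMap.adjoint_inner_right, ← hJt, hCs,
      ← ContinuousLinearMap.adjoint_inner_left J]
  have hRinj : Function.Injective R := by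
    intro x y hxy
    have h1 : C (Jt x) = C (Jt y) := hJ hxy
    exact hJt_inj (by rw [← hBC' (Jt x), h1, hBC'])
  obtain ⟨H, hHs, hHg⟩ := exists_isSelfAdjoint_of_resolvent hRs hRinj b
  have hgraph : ∀ u f, (u, f) ∈ H.graph ↔
      ∃ g, J g = u ∧ ∀ g', inner ℂ g' (B g) = inner ℂ (J g') (f + (b : ℂ) • u) := by
    intro u f
    rw [hHg]
    constructor
    · intro h
      refine ⟨C (Jt (f + (b : ℂ) • u)), h, fun g' => ?_⟩
      rw [hBC', hJt, ContinuousLinearMap.adjoint_inner_right]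
    · rintro ⟨g, rfl, hg⟩
      have : B g = Jt (f + (b : ℂ) • J g) := by
        refine ext_inner_left ℂ fun g' => ?_
        rw [hg, hJt, ContinuousLinearMap.adjoint_inner_right]
      change J (C (Jt _)) = _
      rw [← this, hCB']
  have hform : ∀ (x : H.domain) (g : E), J g = x →
      inner ℂ (x : E) (H x) = inner ℂ g (B g) - ((b * ‖(x : E)‖ ^ 2 : ℝ) : ℂ) := by
    intro x g hg
    obtain ⟨g₁, hg₁, h⟩ := (hgraph x (H x)).1 (H.mem_graph x)
    obtain rfl : g₁ = g := hJ (hg₁.trans hg.symm)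
    have h1 := h g₁
    rw [hg, inner_add_right, inner_smul_right, inner_self_eq_norm_sq_to_K] at h1
    rw [h1]
    push_cast
    exact (add_sub_cancel_right _ _).symm
  have hdom : ∀ x : H.domain, ∃ g, J g = x := fun x =>
    ((hgraph x (H x)).1 (H.mem_graph x)).imp fun _ h => h.1
  refine ⟨H, hHs, hgraph, ⟨-b, fun x => ?_⟩, ?_⟩
  · obtain ⟨g, hg⟩ := hdom x
    rw [hform x g hg, Complex.sub_re, Complex.ofReal_re]
    have := hcoer g
    nlinarith [mul_nonneg hc.le (sq_nonneg ‖g‖)]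
  · ext u
    constructor
    · rintro ⟨x, hxu, hx⟩
      choose g hg using fun k => hdom (x k)
      -- By `hform` and coercivity, a sequence that is Cauchy both in norm and for the form of `H`
      -- has Cauchy preimages under `J`.
      have hcau : CauchySeq g := by
        rw [cauchySeq_iff_tendsto_dist_atTop_0]
        have h1 : Tendsto (fun p : ℕ × ℕ => ‖(x p.1 : E) - x p.2‖) atTop (𝓝 0) := by
          have := cauchySeq_iff_tendsto_dist_atTop_0.1 hxu.cauchySeq
          simpa only [dist_eq_norm] using this
        have h2 : Tendsto (fun p : ℕ × ℕ => c⁻¹ *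
            ((inner ℂ ((x p.1 - x p.2 : H.domain) : E) (H (x p.1 - x p.2))).re
              + b * ‖(x p.1 : E) - x p.2‖ ^ 2)) atTop (𝓝 0) := by
          have := (((Complex.continuous_re.tendsto _).comp hx).add
            ((h1.pow 2).const_mul b)).const_mul c⁻¹
          simpa using this
        have h3 : Tendsto (fun p : ℕ × ℕ => dist (g p.1) (g p.2) ^ 2) atTop (𝓝 0) := by
          refine squeeze_zero (fun _ => by positivity) (fun p => ?_) h2
          have e := hform (x p.1 - x p.2) (g p.1 - g p.2) (by simp [hg])
          rw [e, Complex.sub_re, Complex.ofReal_re, dist_eq_norm, le_inv_mul_iff₀ hc]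
          have := hcoer (g p.1 - g p.2)
          simpa using this
        have h4 := h3.sqrt
        simpa [Real.sqrt_sq dist_nonneg] using h4
      obtain ⟨g₀, hg₀⟩ := cauchySeq_tendsto_of_complete hcau
      refine ⟨g₀, tendsto_nhds_unique ((J.continuous.tendsto _).comp hg₀) ?_⟩
      simpa only [Function.comp_def, hg] using hxu
    · rintro ⟨g, rfl⟩
      -- The preimages under `J` of the domain of `H` are the vectors `B⁻¹ J* h`. They are dense, so
      -- every `J g` is a limit of domain elements whose preimages converge.
      have hd : DenseRange (fun h => C (Jt h)) :=
        (show DenseRange C from (Function.RightInverse.surjective hCB').denseRange).comp hJt_dense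
          C.continuous
      obtain ⟨h, hh⟩ : ∃ h : ℕ → E, Tendsto (fun k => C (Jt (h k))) atTop (𝓝 g) := by
        obtain ⟨y, hy, hyg⟩ := mem_closure_iff_seq_limit.1 (hd g)
        choose h hh using hy
        exact ⟨h, by simpa only [hh] using hyg⟩
      have hmem : ∀ k, R (h k) ∈ H.domain := by
        intro k
        have : (R (h k), h k - (b : ℂ) • R (h k)) ∈ H.graph := by
          rw [hHg, sub_add_cancel]
        exact LinearPMap.mem_domain_of_mem_graph this
      have hlim : Tendsto (fun k => R (h k)) atTop (𝓝 (J g)) := (J.continuous.tendsto _).comp hh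
      refine ⟨fun k => ⟨R (h k), hmem k⟩, hlim, ?_⟩
      have e : ∀ p : ℕ × ℕ, inner ℂ ((⟨R (h p.1), hmem p.1⟩ - ⟨R (h p.2), hmem p.2⟩ : H.domain) : E)
          (H (⟨R (h p.1), hmem p.1⟩ - ⟨R (h p.2), hmem p.2⟩)) =
          inner ℂ (C (Jt (h p.1)) - C (Jt (h p.2))) (B (C (Jt (h p.1)) - C (Jt (h p.2))))
            - ((b * ‖R (h p.1) - R (h p.2)‖ ^ 2 : ℝ) : ℂ) := by
        intro p
        exact hform _ (C (Jt (h p.1)) - C (Jt (h p.2))) (by simp [R])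
      simp only [e]
      have t1 : Tendsto (fun p : ℕ × ℕ => C (Jt (h p.1)) - C (Jt (h p.2))) atTop (𝓝 0) := by
        have := (hh.comp (tendsto_fst (g := (atTop : Filter ℕ)))).sub
          (hh.comp (tendsto_snd (f := (atTop : Filter ℕ))))
        rw [prod_atTop_atTop_eq, sub_self] at this
        exact this
      have F : Continuous (fun v : E => inner ℂ v (B v) - ((b * ‖J v‖ ^ 2 : ℝ) : ℂ)) := by fun_prop
      have := (F.tendsto 0).comp t1
      simpa [R, Function.comp_def] using this

end FormOperator

/-! ### `H¹` as the range of a Bessel potential; density of Schwartz functions -/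

section BesselPotential

variable {n : ℕ}

theorem toTemperedDistribution_injective {f g : L2 n}
    (h : (f : 𝓢'(Space n, ℂ)) = (g : 𝓢'(Space n, ℂ))) : f = g :=
  LinearMap.ker_eq_bot.1 (Lp.ker_toTemperedDistributionCLM_eq_bot (F := ℂ)
    (μ := (volume : Measure (Space n))) (p := 2)) h

theorem coe_weakPartial (i : Fin n) (u : H1 n) :
    ((weakPartial i u : L2 n) : 𝓢'(Space n, ℂ)) = ∂_{basisVec i} ((u : L2 n) : 𝓢'(Space n, ℂ)) :=
  (exists_weakPartial i u).choose_spec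

theorem weakPartial_eq {i : Fin n} {u : H1 n} {g : L2 n}
    (h : (g : 𝓢'(Space n, ℂ)) = ∂_{basisVec i} ((u : L2 n) : 𝓢'(Space n, ℂ))) :
    weakPartial i u = g :=
  toTemperedDistribution_injective ((coe_weakPartial i u).trans h.symm)

theorem weakPartial_add (i : Fin n) (u v : H1 n) :
    weakPartial i (u + v) = weakPartial i u + weakPartial i v := by
  apply weakPartial_eq
  have h : ∀ f g : L2 n, ((f + g : L2 n) : 𝓢'(Space n, ℂ)) = f + g :=
    map_add (Lp.toTemperedDistributionCLM ℂ (volume : Measure (Space n)) 2)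
  rw [Submodule.coe_add, h, h, coe_weakPartial, coe_weakPartial, LineDeriv.lineDerivOp_add]

theorem weakPartial_smul (i : Fin n) (c : ℂ) (u : H1 n) :
    weakPartial i (c • u) = c • weakPartial i u := by
  apply weakPartial_eq
  have h : ∀ f : L2 n, ((c • f : L2 n) : 𝓢'(Space n, ℂ)) = c • (f : 𝓢'(Space n, ℂ)) :=
    map_smul (Lp.toTemperedDistributionCLM ℂ (volume : Measure (Space n)) 2) c
  rw [Submodule.coe_smul, h, h, coe_weakPartial, LineDeriv.lineDerivOp_smul]

theorem toLp_mem_H1 (φ : 𝓢(Space n, ℂ)) : φ.toLp 2 volume ∈ H1 n := by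
  change TemperedDistribution.MemSobolev 1 2 ((φ.toLp 2 volume : L2 n) : 𝓢'(Space n, ℂ))
  rw [Lp.toTemperedDistribution_toLp_eq]
  exact φ.memSobolev

theorem weakPartial_toLp (i : Fin n) (φ : 𝓢(Space n, ℂ)) :
    weakPartial i ⟨φ.toLp 2 volume, toLp_mem_H1 φ⟩ = (∂_{basisVec i} φ).toLp 2 volume := by
  apply weakPartial_eq
  rw [Lp.toTemperedDistribution_toLp_eq, Lp.toTemperedDistribution_toLp_eq,
    TemperedDistribution.lineDerivOp_toTemperedDistributionCLM_eq]

open FourierTransform ENNReal in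
/-- Fourier multipliers with bounded symbols act on `L²`. -/
theorem exists_fourierMultiplier {σ : Space n → ℂ} (hσ : σ.HasTemperateGrowth) {C : ℝ}
    (hC : ∀ x, ‖σ x‖ ≤ C) : ∃ T : L2 n →L[ℂ] L2 n, ∀ g : L2 n,
      ((T g : L2 n) : 𝓢'(Space n, ℂ)) =
        TemperedDistribution.fourierMultiplierCLM ℂ σ (g : 𝓢'(Space n, ℂ)) := by
  have hm : MemLp σ ∞ (volume : Measure (Space n)) :=
    memLp_top_of_bound hσ.1.continuous.aestronglyMeasurable C (.of_forall hC)
  -- Multiplication by `σ` on the Fourier side, bounded by Hölder's inequality.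
  let M : L2 n →L[ℂ] L2 n := (ContinuousLinearMap.mul ℂ ℂ).holderL volume ∞ 2 2 (hm.toLp σ)
  have hM : ∀ g : L2 n, M g = (hm.toLp σ • g : L2 n) := fun g => rfl
  refine ⟨((Lp.fourierTransformₗᵢ (Space n) ℂ).symm : L2 n →L[ℂ] L2 n) ∘L M ∘L
    ((Lp.fourierTransformₗᵢ (Space n) ℂ) : L2 n →L[ℂ] L2 n), fun g => ?_⟩
  change ((𝓕⁻ (M (𝓕 g)) : L2 n) : 𝓢'(Space n, ℂ)) = _
  rw [← Lp.fourierInv_toTemperedDistribution_eq, hM, Lp.toTemperedDistribution_smul_eq hσ,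
    ← Lp.fourier_toTemperedDistribution_eq]
  rfl

/-- The symbol of the Bessel potential of order `-1`. -/
noncomputable def besselSymbol (n : ℕ) (x : Space n) : ℂ :=
  (((1 + ‖x‖ ^ 2) ^ ((-1 : ℝ) / 2) : ℝ) : ℂ)

/-- The symbol of a partial derivative of the Bessel potential of order `-1`, up to a constant. -/
noncomputable def rieszSymbol (i : Fin n) (x : Space n) : ℂ :=
  ((inner ℝ x (basisVec i) : ℝ) : ℂ) * besselSymbol n x

theorem hasTemperateGrowth_besselSymbol : (besselSymbol n).HasTemperateGrowth := by
  unfold besselSymbol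
  fun_prop

theorem hasTemperateGrowth_rieszSymbol (i : Fin n) : (rieszSymbol i).HasTemperateGrowth := by
  unfold rieszSymbol besselSymbol
  fun_prop

theorem inner_basisVec (x : Space n) (i : Fin n) : inner ℝ x (basisVec i) = x i := by
  simp [basisVec, EuclideanSpace.inner_single_right]

theorem besselSymbol_mul_self (x : Space n) :
    besselSymbol n x * besselSymbol n x = (((1 + ‖x‖ ^ 2)⁻¹ : ℝ) : ℂ) := by
  rw [besselSymbol, ← Complex.ofReal_mul, ← Real.rpow_add (by positivity), ← Real.rpow_neg_one]
  norm_num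

/-- This is `(1 + |x|²) / (1 + |x|²) = 1`. On operators it reads `g = J J g + ∑ Rᵢ Rᵢ g`, from which
`‖g‖` is recovered from the `H¹` norm of `J g`. -/
theorem besselSymbol_sq_add_sum (x : Space n) :
    besselSymbol n x * besselSymbol n x + ∑ i, rieszSymbol i x * rieszSymbol i x = 1 := by
  have h : ∀ i, rieszSymbol i x * rieszSymbol i x =
      ((x i ^ 2 : ℝ) : ℂ) * (((1 + ‖x‖ ^ 2)⁻¹ : ℝ) : ℂ) := by
    intro i
    rw [rieszSymbol, inner_basisVec, ← besselSymbol_mul_self]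
    push_cast
    ring
  simp_rw [h, besselSymbol_mul_self, ← Finset.sum_mul, ← Complex.ofReal_sum,
    ← EuclideanSpace.real_norm_sq_eq]
  rw [← Complex.ofReal_mul, ← Complex.ofReal_add, ← one_add_mul, mul_inv_cancel₀ (by positivity),
    Complex.ofReal_one]

theorem norm_besselSymbol_le (x : Space n) : ‖besselSymbol n x‖ ≤ 1 := by
  rw [besselSymbol, Complex.norm_real, Real.norm_of_nonneg (by positivity)]
  exact Real.rpow_le_one_of_one_le_of_nonpos (by simp) (by norm_num)

theorem norm_rieszSymbol_le (i : Fin n) (x : Space n) : ‖rieszSymbol i x‖ ≤ 1 := by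
  refine le_of_sq_le_sq ?_ zero_le_one
  have h1 : ‖rieszSymbol i x‖ ^ 2 = x i ^ 2 * (1 + ‖x‖ ^ 2)⁻¹ := by
    rw [rieszSymbol, norm_mul, mul_pow, inner_basisVec, Complex.norm_real, Real.norm_eq_abs, sq_abs,
      sq ‖besselSymbol n x‖, ← norm_mul, besselSymbol_mul_self, Complex.norm_real,
      Real.norm_of_nonneg (by positivity)]
  rw [h1, one_pow, mul_inv_le_iff₀ (by positivity), one_mul]
  have h2 : ‖x i‖ ≤ ‖x‖ := PiLp.norm_apply_le x i
  have h3 : x i ^ 2 ≤ ‖x‖ ^ 2 := by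
    rw [← sq_abs, ← Real.norm_eq_abs]
    gcongr
  linarith

open TemperedDistribution in
/-- The Bessel potential of order `-1` maps `L²` onto `H¹`, with equivalence of norms, and preserves
Schwartz functions. -/
theorem exists_besselPotential (n : ℕ) :
    ∃ (J : L2 n →L[ℂ] L2 n) (D : Fin n → L2 n →L[ℂ] L2 n) (K : ℝ),
      Function.Injective J ∧ (∀ u, u ∈ H1 n ↔ ∃ g, J g = u) ∧
      (∀ i g (h : J g ∈ H1 n), weakPartial i ⟨J g, h⟩ = D i g) ∧
      (0 < K ∧ ∀ g, ‖g‖ ≤ K * (‖J g‖ + ∑ i, ‖D i g‖)) ∧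
      ∀ φ : 𝓢(Space n, ℂ), ∃ ψ : 𝓢(Space n, ℂ), J (φ.toLp 2 volume) = ψ.toLp 2 volume := by
  obtain ⟨J, hJ⟩ := exists_fourierMultiplier (hasTemperateGrowth_besselSymbol (n := n))
    norm_besselSymbol_le
  choose R hR using fun i : Fin n => exists_fourierMultiplier (hasTemperateGrowth_rieszSymbol i)
    (norm_rieszSymbol_le i)
  have hJ' : ∀ g : L2 n, ((J g : L2 n) : 𝓢'(Space n, ℂ)) =
      besselPotential (Space n) ℂ (-1) (g : 𝓢'(Space n, ℂ)) := hJ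
  -- In this Fourier normalization `∂ᵢ` has symbol `2πi xᵢ`, so `∂ᵢ J = κ Rᵢ`.
  let κ : ℂ := 2 * Real.pi * Complex.I
  have hκ : κ ≠ 0 := by simp [κ, Real.pi_ne_zero]
  have hid : ∀ g : L2 n, g = J (J g) + ∑ i, R i (R i g) := by
    intro g
    apply toTemperedDistribution_injective
    have hadd := map_add (Lp.toTemperedDistributionCLM ℂ (volume : Measure (Space n)) 2)
    have hsum := fun f : Fin n → L2 n =>
      map_sum (Lp.toTemperedDistributionCLM ℂ (volume : Measure (Space n)) 2) f Finset.univ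
    simp only [Lp.toTemperedDistributionCLM_apply] at hadd hsum
    rw [hadd, hsum, hJ, hJ, fourierMultiplierCLM_fourierMultiplierCLM_apply
      hasTemperateGrowth_besselSymbol hasTemperateGrowth_besselSymbol]
    have h2 : ∀ i, ((R i (R i g) : L2 n) : 𝓢'(Space n, ℂ)) =
        fourierMultiplierCLM ℂ (rieszSymbol i * rieszSymbol i) (g : 𝓢'(Space n, ℂ)) := by
      intro i
      rw [hR, hR, fourierMultiplierCLM_fourierMultiplierCLM_apply
        (hasTemperateGrowth_rieszSymbol i) (hasTemperateGrowth_rieszSymbol i)]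
    -- The index `none` carries the squared Bessel symbol, so that all `n + 1` symbols form one sum,
    -- equal to `1`.
    have h3 := fourierMultiplierCLM_sum (E := Space n) ℂ (s := Finset.univ)
      (g := fun o : Option (Fin n) => o.elim (besselSymbol n * besselSymbol n)
        fun i => rieszSymbol i * rieszSymbol i) (by
        rintro (_ | i) _
        · exact hasTemperateGrowth_besselSymbol.mul hasTemperateGrowth_besselSymbol
        · exact (hasTemperateGrowth_rieszSymbol i).mul (hasTemperateGrowth_rieszSymbol i))
    simp only [Fintype.sum_option, Option.elim_none, Option.elim_some, Pi.mul_apply,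
      besselSymbol_sq_add_sum] at h3
    rw [fourierMultiplierCLM_const] at h3
    have h4 := congrArg (fun T => T (g : 𝓢'(Space n, ℂ))) h3
    simp only [one_smul] at h4
    simp_rw [h2]
    refine Eq.trans ?_ (h4.trans ?_)
    · rfl
    · simp
  have hD : ∀ i g (h : J g ∈ H1 n), weakPartial i ⟨J g, h⟩ = (κ • R i) g := by
    intro i g h
    apply weakPartial_eq
    have hs : ((κ • R i g : L2 n) : 𝓢'(Space n, ℂ)) = κ • ((R i g : L2 n) : 𝓢'(Space n, ℂ)) :=
      map_smul (Lp.toTemperedDistributionCLM ℂ (volume : Measure (Space n)) 2) κ _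
    rw [_root_.smul_apply, hs, hR, hJ, lineDeriv_eq_fourierMultiplierCLM,
      fourierMultiplierCLM_fourierMultiplierCLM_apply hasTemperateGrowth_besselSymbol (by fun_prop),
      mul_comm (besselSymbol n)]
    rfl
  -- The constant comes from `hid` and the operator norms; the summand `1` makes it positive.
  refine ⟨J, fun i => κ • R i, ‖J‖ + ∑ i, ‖κ‖⁻¹ * ‖R i‖ + 1, ?_, ?_, hD, ⟨?_, ?_⟩, ?_⟩
  · intro f g hfg
    apply toTemperedDistribution_injective
    have := congrArg (fun u : L2 n => besselPotential (Space n) ℂ 1 (u : 𝓢'(Space n, ℂ))) hfg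
    simpa [hJ'] using this
  · intro u
    constructor
    · rintro ⟨g, hg⟩
      refine ⟨g, toTemperedDistribution_injective ?_⟩
      rw [hJ', ← hg]
      simp
    · rintro ⟨g, rfl⟩
      refine ⟨g, ?_⟩
      rw [hJ']
      simp
  · positivity
  · intro g
    have h1 : ∀ i, ‖R i (R i g)‖ ≤ ‖κ‖⁻¹ * ‖R i‖ * ‖(κ • R i) g‖ := by
      intro i
      rw [_root_.smul_apply, norm_smul]
      refine ((R i).le_opNorm _).trans (le_of_eq ?_)
      have := norm_ne_zero_iff.2 hκ
      field_simp
    have hJ0 := norm_nonneg J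
    have hR0 : ∀ i, 0 ≤ ‖κ‖⁻¹ * ‖R i‖ := fun i => by positivity
    set S := ∑ i, ‖κ‖⁻¹ * ‖R i‖
    have hS : 0 ≤ S := Finset.sum_nonneg fun i _ => hR0 i
    have hDs : 0 ≤ ∑ i, ‖(κ • R i) g‖ := Finset.sum_nonneg fun i _ => norm_nonneg _
    calc ‖g‖ = ‖J (J g) + ∑ i, R i (R i g)‖ := by rw [← hid]
      _ ≤ ‖J‖ * ‖J g‖ + ∑ i, ‖κ‖⁻¹ * ‖R i‖ * ‖(κ • R i) g‖ :=
        (norm_add_le _ _).trans (add_le_add (J.le_opNorm _)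
          ((norm_sum_le _ _).trans (Finset.sum_le_sum fun i _ => h1 i)))
      _ ≤ ‖J‖ * ‖J g‖ + ∑ i, S * ‖(κ • R i) g‖ := by
        gcongr with i
        exact Finset.single_le_sum (f := fun i => ‖κ‖⁻¹ * ‖R i‖) (fun i _ => hR0 i)
          (Finset.mem_univ i)
      _ ≤ (‖J‖ + S + 1) * (‖J g‖ + ∑ i, ‖(κ • R i) g‖) := by
        rw [← Finset.mul_sum]
        nlinarith [norm_nonneg (J g), mul_nonneg hS (norm_nonneg (J g)), mul_nonneg hJ0 hDs]
  · intro φ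
    refine ⟨SchwartzMap.fourierMultiplierCLM ℂ (besselSymbol n) φ,
      toTemperedDistribution_injective ?_⟩
    rw [hJ, Lp.toTemperedDistribution_toLp_eq, Lp.toTemperedDistribution_toLp_eq,
      fourierMultiplierCLM_toTemperedDistributionCLM_eq hasTemperateGrowth_besselSymbol]

/-- Schwartz functions are dense in `H¹`. -/
theorem exists_schwartz_tendsto (u : H1 n) : ∃ φ : ℕ → 𝓢(Space n, ℂ),
    Tendsto (fun k => (φ k).toLp 2 volume) atTop (𝓝 (u : L2 n)) ∧
    ∀ i, Tendsto (fun k => (∂_{basisVec i} (φ k)).toLp 2 volume) atTop (𝓝 (weakPartial i u)) := by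
  obtain ⟨J, D, -, -, hran, hD, -, hS⟩ := exists_besselPotential n
  obtain ⟨u, hu⟩ := u
  obtain ⟨g, rfl⟩ := (hran u).1 hu
  have hdense := SchwartzMap.denseRange_toLpCLM (E := Space n) (F := ℂ) (p := 2)
    (μ := volume) ENNReal.ofNat_ne_top
  obtain ⟨y, hy, hyg⟩ := mem_closure_iff_seq_limit.1 (hdense g)
  choose ψ hψ using hy
  choose φ hφ using fun k => hS (ψ k)
  have hφy : ∀ k, (φ k).toLp 2 volume = J (y k) := fun k => by rw [← hφ, ← hψ]; rfl
  refine ⟨φ, ?_, fun i => ?_⟩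
  · simp only [hφy]
    exact (J.continuous.tendsto _).comp hyg
  · have h : ∀ k, (∂_{basisVec i} (φ k)).toLp 2 volume = D i (y k) := by
      intro k
      rw [← weakPartial_toLp, ← hD i (y k) ((hran _).2 ⟨_, rfl⟩)]
      simp only [hφy]
    simp only [h, hD]
    exact ((D i).continuous.tendsto _).comp hyg

end BesselPotential

/-! ### The trace inequality for measures of dimension greater than `n - 2` -/

section TraceInequality

open Metric ENNReal Set

variable {n : ℕ}

/-- Averages over balls are integrable against a measure with a bound on the mass of balls. -/
theorem lintegral_ball_translate_le {ν : Measure (Space n)} [SFinite ν] {r : ℝ} {M : ℝ≥0∞}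
    (hν : ∀ x, ν (ball x r) ≤ M) {g : Space n → ℝ≥0∞} (hg : Measurable g) :
    ∫⁻ x, (∫⁻ z in ball 0 r, g (x + z)) ∂ν ≤ M * ∫⁻ y, g y := by
  have h1 : ∀ x : Space n, ∫⁻ z in ball 0 r, g (x + z) = ∫⁻ y, (ball x r).indicator g y := by
    intro x
    rw [← lintegral_indicator measurableSet_ball,
      ← lintegral_add_left_eq_self (μ := volume) ((ball x r).indicator g) x]
    refine lintegral_congr fun z => ?_
    simp only [indicator, mem_ball, dist_eq_norm, sub_zero, add_sub_cancel_left]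
  have hmeas : Measurable (fun p : Space n × Space n => (ball p.1 r).indicator g p.2) := by
    have hs : MeasurableSet {p : Space n × Space n | dist p.2 p.1 < r} :=
      (isOpen_lt (by fun_prop) (by fun_prop)).measurableSet
    have := (hg.comp measurable_snd).indicator hs
    exact this
  simp_rw [h1]
  rw [lintegral_lintegral_swap hmeas.aemeasurable, ← lintegral_const_mul _ hg]
  refine lintegral_mono fun y => ?_
  -- After Tonelli, `y ∈ B(x, r)` is read as `x ∈ B(y, r)`, and the inner integral is the mass of a
  -- ball times `g y`.
  have h2 : ∀ x, (ball x r).indicator g y = (ball y r).indicator (fun _ => g y) x := by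
    intro x
    simp only [indicator, mem_ball, dist_comm]
  simp_rw [h2]
  rw [lintegral_indicator measurableSet_ball, lintegral_const, Measure.restrict_apply_univ, mul_comm]
  gcongr
  exact hν y

theorem setLIntegral_ball_comp_smul {t ε : ℝ} (ht : 0 < t) (g : Space n → ℝ≥0∞)
    (hg : Measurable g) :
    ∫⁻ h in ball 0 ε, g (t • h) = ENNReal.ofReal ((t ^ n)⁻¹) * ∫⁻ z in ball 0 (t * ε), g z := by
  have h1 : ∀ h : Space n, (ball 0 ε).indicator (fun h => g (t • h)) h =
      (ball 0 (t * ε)).indicator g (t • h) := by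
    intro h
    simp only [indicator, mem_ball, dist_zero_right, norm_smul, Real.norm_of_nonneg ht.le,
      mul_lt_mul_iff_right₀ ht]
  rw [← lintegral_indicator measurableSet_ball, ← lintegral_indicator measurableSet_ball]
  simp_rw [h1]
  have hm : Measurable fun h : Space n => t • h := by fun_prop
  rw [← lintegral_map (hg.indicator measurableSet_ball) hm,
    Measure.map_addHaar_smul _ ht.ne', lintegral_smul_measure, finrank_euclideanSpace_fin,
    abs_of_nonneg (by positivity), smul_eq_mul]

theorem enorm_sq_le_of_add {a b c : ℂ} {A : ℝ≥0∞} (h : a = b - c) (hc : ‖c‖ₑ ^ 2 ≤ A) :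
    ‖a‖ₑ ^ 2 ≤ 2 * ‖b‖ₑ ^ 2 + 2 * A := by
  have h1 : ‖a‖ ^ 2 ≤ 2 * ‖b‖ ^ 2 + 2 * ‖c‖ ^ 2 := by
    have := norm_sub_le b c
    rw [← h] at this
    nlinarith [norm_nonneg a, sq_nonneg (‖b‖ - ‖c‖)]
  have h2 : ‖a‖ₑ ^ 2 ≤ 2 * ‖b‖ₑ ^ 2 + 2 * ‖c‖ₑ ^ 2 := by
    have := ENNReal.ofReal_le_ofReal h1
    rw [ENNReal.ofReal_add (by positivity) (by positivity), ENNReal.ofReal_mul (by norm_num),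
      ENNReal.ofReal_mul (by norm_num), ENNReal.ofReal_pow (norm_nonneg _),
      ENNReal.ofReal_pow (norm_nonneg _), ENNReal.ofReal_pow (norm_nonneg _)] at this
    simpa using this
  exact h2.trans (by gcongr)

theorem lintegral_rpow_sub_one {δ : ℝ} (hδ : 0 < δ) :
    ∫⁻ t in Ioc (0 : ℝ) 1, ENNReal.ofReal (t ^ (δ - 1)) = ENNReal.ofReal δ⁻¹ := by
  have hi : IntervalIntegrable (fun t : ℝ => t ^ (δ - 1)) volume 0 1 :=
    intervalIntegral.intervalIntegrable_rpow' (by linarith)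
  rw [← ofReal_integral_eq_lintegral_ofReal ((intervalIntegrable_iff_integrableOn_Ioc_of_le
    zero_le_one).1 hi) ((ae_restrict_mem measurableSet_Ioc).mono fun t ht =>
      Real.rpow_nonneg ht.1.le _),
    ← intervalIntegral.integral_of_le zero_le_one, integral_rpow (Or.inl (by linarith))]
  rw [Real.one_rpow, sub_add_cancel, Real.zero_rpow hδ.ne', sub_zero, one_div]

/-- Cauchy–Schwarz with `1 = t^((δ-1)/2) t^((1-δ)/2)`. The weight is needed because the mass bound
later contributes `t^(α-n) = t^(2δ-2)`, which need not be integrable at `0`; times `t^(1-δ)` it is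
the integrable `t^(δ-1)`. -/
theorem sq_lintegral_le {δ : ℝ} (hδ : 0 < δ) {f : ℝ → ℝ≥0∞} (hf : Measurable f) :
    (∫⁻ t in Ioc (0 : ℝ) 1, f t) ^ 2 ≤
      ENNReal.ofReal δ⁻¹ * ∫⁻ t in Ioc (0 : ℝ) 1, ENNReal.ofReal (t ^ (1 - δ)) * f t ^ 2 := by
  let u : ℝ → ℝ≥0∞ := fun t => ENNReal.ofReal (t ^ ((δ - 1) / 2))
  let w : ℝ → ℝ≥0∞ := fun t => ENNReal.ofReal (t ^ ((1 - δ) / 2)) * f t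
  have hu : Measurable u := by fun_prop
  have hw : Measurable w := by fun_prop
  have h1 : ∫⁻ t in Ioc (0 : ℝ) 1, f t = ∫⁻ t in Ioc (0 : ℝ) 1, (u * w) t := by
    refine setLIntegral_congr_fun measurableSet_Ioc fun t ht => ?_
    simp only [u, w, Pi.mul_apply]
    rw [← mul_assoc, ← ENNReal.ofReal_mul (Real.rpow_nonneg ht.1.le _), ← Real.rpow_add ht.1]
    rw [show (δ - 1) / 2 + (1 - δ) / 2 = 0 by ring, Real.rpow_zero, ENNReal.ofReal_one, one_mul]
  have h2 := ENNReal.lintegral_mul_le_Lp_mul_Lq (volume.restrict (Ioc (0 : ℝ) 1))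
    Real.HolderConjugate.two_two hu.aemeasurable hw.aemeasurable
  have h3 : ∫⁻ t in Ioc (0 : ℝ) 1, u t ^ (2 : ℝ) = ENNReal.ofReal δ⁻¹ := by
    rw [← lintegral_rpow_sub_one hδ]
    refine setLIntegral_congr_fun measurableSet_Ioc fun t ht => ?_
    simp only [u]
    rw [ENNReal.ofReal_rpow_of_nonneg (Real.rpow_nonneg ht.1.le _) (by norm_num),
      ← Real.rpow_mul ht.1.le]
    congr 2
    ring
  have h4 : ∫⁻ t in Ioc (0 : ℝ) 1, w t ^ (2 : ℝ) =
      ∫⁻ t in Ioc (0 : ℝ) 1, ENNReal.ofReal (t ^ (1 - δ)) * f t ^ 2 := by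
    refine setLIntegral_congr_fun measurableSet_Ioc fun t ht => ?_
    simp only [w]
    rw [ENNReal.rpow_two, mul_pow, ← ENNReal.ofReal_pow (Real.rpow_nonneg ht.1.le _),
      ← Real.rpow_mul_natCast ht.1.le]
    congr 3
    push_cast
    ring
  rw [h3, h4] at h2
  rw [h1]
  refine (pow_le_pow_left' h2 2).trans (le_of_eq ?_)
  rw [mul_pow, ← ENNReal.rpow_two, ← ENNReal.rpow_two, ← ENNReal.rpow_mul, ← ENNReal.rpow_mul]
  norm_num

/-- The fundamental theorem of calculus on the segment from `x` to `x + h`, followed by the weighted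
Cauchy–Schwarz inequality `sq_lintegral_le`. -/
theorem enorm_sq_le_segment {δ ε : ℝ} (hδ : 0 < δ) (φ : 𝓢(Space n, ℂ)) (x : Space n)
    {h : Space n} (hh : ‖h‖ ≤ ε) :
    ‖φ x‖ₑ ^ 2 ≤ 2 * ‖φ (x + h)‖ₑ ^ 2 + 2 * (ENNReal.ofReal (ε ^ 2 * δ⁻¹) *
      ∫⁻ t in Ioc (0 : ℝ) 1, ENNReal.ofReal (t ^ (1 - δ)) * ‖fderiv ℝ φ (x + t • h)‖ₑ ^ 2) := by
  have hdiff : Differentiable ℝ φ := φ.differentiable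
  have hcont : Continuous (fderiv ℝ φ) := (φ.smooth 1).continuous_fderiv (by norm_num)
  have hderiv : ∀ t : ℝ, HasDerivAt (fun t : ℝ => φ (x + t • h)) (fderiv ℝ φ (x + t • h) h) t := by
    intro t
    have h1 : HasDerivAt (fun t : ℝ => x + t • h) h t := by
      simpa using ((hasDerivAt_id t).smul_const h).const_add x
    exact (hdiff _).hasFDerivAt.comp_hasDerivAt t h1
  have hftc := intervalIntegral.integral_eq_sub_of_hasDerivAt (a := 0) (b := 1)
    (fun t _ => hderiv t) (Continuous.intervalIntegrable (by fun_prop) _ _)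
  rw [intervalIntegral.integral_of_le zero_le_one] at hftc
  simp only [one_smul, zero_smul, add_zero] at hftc
  refine enorm_sq_le_of_add (c := φ (x + h) - φ x) (by ring) ?_
  rw [← hftc]
  have hε : 0 ≤ ε := (norm_nonneg h).trans hh
  have hm : Measurable fun t : ℝ => ‖fderiv ℝ φ (x + t • h)‖ₑ :=
    Continuous.measurable (by fun_prop)
  calc ‖∫ t in Ioc (0 : ℝ) 1, fderiv ℝ φ (x + t • h) h‖ₑ ^ 2
      ≤ (∫⁻ t in Ioc (0 : ℝ) 1, ENNReal.ofReal ε * ‖fderiv ℝ φ (x + t • h)‖ₑ) ^ 2 := by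
        gcongr
        refine (enorm_integral_le_lintegral_enorm _).trans (lintegral_mono fun t => ?_)
        rw [mul_comm]
        refine (ContinuousLinearMap.le_opENorm _ _).trans ?_
        gcongr
        rw [← ofReal_norm]
        exact ENNReal.ofReal_le_ofReal hh
    _ = ENNReal.ofReal (ε ^ 2) * (∫⁻ t in Ioc (0 : ℝ) 1, ‖fderiv ℝ φ (x + t • h)‖ₑ) ^ 2 := by
        rw [lintegral_const_mul _ hm, mul_pow, ENNReal.ofReal_pow hε]
    _ ≤ _ := by
        rw [ENNReal.ofReal_mul (by positivity), mul_assoc]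
        gcongr
        exact sq_lintegral_le hδ hm

/-- A trace inequality for Schwartz functions, at scale `ε`. -/
theorem lintegral_enorm_sq_le {ν : Measure (Space n)} [SFinite ν] {C α δ ε : ℝ} (hC : 0 ≤ C)
    (hδ : 0 < δ) (hα : α = n - 2 + 2 * δ) (hε : 0 < ε)
    (hν : ∀ x r, 0 < r → ν (ball x r) ≤ ENNReal.ofReal (C * r ^ α)) (φ : 𝓢(Space n, ℂ)) :
    volume (ball (0 : Space n) ε) * ∫⁻ x, ‖φ x‖ₑ ^ 2 ∂ν ≤
      ENNReal.ofReal (2 * C * ε ^ α) * (∫⁻ x, ‖φ x‖ₑ ^ 2) +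
      ENNReal.ofReal (2 * (ε ^ 2 * δ⁻¹) * (C * ε ^ α * δ⁻¹)) * ∫⁻ x, ‖fderiv ℝ φ x‖ₑ ^ 2 := by
  have hcont : Continuous (fderiv ℝ φ) := (φ.smooth 1).continuous_fderiv (by norm_num)
  have hφ : Measurable fun x => ‖φ x‖ₑ ^ 2 := φ.continuous.enorm.measurable.pow_const 2
  have hD : Measurable fun x => ‖fderiv ℝ φ x‖ₑ ^ 2 := hcont.enorm.measurable.pow_const 2
  set I := ∫⁻ x, ‖fderiv ℝ φ x‖ₑ ^ 2
  -- Substituting `z = th` costs `t^(-n)` and shrinks the ball to radius `tε`, where the mass bound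
  -- gives `C(tε)^α`.
  have hball : ∀ t ∈ Ioc (0 : ℝ) 1, ∫⁻ x, (∫⁻ h in ball (0 : Space n) ε,
      ‖fderiv ℝ φ (x + t • h)‖ₑ ^ 2) ∂ν ≤
        ENNReal.ofReal ((t ^ n)⁻¹) * (ENNReal.ofReal (C * (t * ε) ^ α) * I) := by
    intro t ht
    have h1 : ∀ x : Space n, ∫⁻ h in ball (0 : Space n) ε, ‖fderiv ℝ φ (x + t • h)‖ₑ ^ 2 =
        ENNReal.ofReal ((t ^ n)⁻¹) *
          ∫⁻ z in ball (0 : Space n) (t * ε), ‖fderiv ℝ φ (x + z)‖ₑ ^ 2 := fun x =>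
      setLIntegral_ball_comp_smul ht.1 (fun z => ‖fderiv ℝ φ (x + z)‖ₑ ^ 2)
        (hD.comp (measurable_const_add x))
    simp_rw [h1]
    rw [lintegral_const_mul' _ _ ENNReal.ofReal_ne_top]
    gcongr
    exact lintegral_ball_translate_le (fun x => hν x _ (mul_pos ht.1 hε)) hD
  have hM : Measurable fun p : (Space n × Space n) × ℝ =>
      ENNReal.ofReal (p.2 ^ (1 - δ)) * ‖fderiv ℝ φ (p.1.1 + p.2 • p.1.2)‖ₑ ^ 2 := by
    have h1 : Measurable fun p : (Space n × Space n) × ℝ => ENNReal.ofReal (p.2 ^ (1 - δ)) := by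
      fun_prop
    have h2 : Continuous fun p : (Space n × Space n) × ℝ => p.1.1 + p.2 • p.1.2 := by fun_prop
    exact h1.mul ((hcont.comp h2).enorm.measurable.pow_const 2)
  have hgrad : ∫⁻ x, (∫⁻ h in ball (0 : Space n) ε, ∫⁻ t in Ioc (0 : ℝ) 1,
      ENNReal.ofReal (t ^ (1 - δ)) * ‖fderiv ℝ φ (x + t • h)‖ₑ ^ 2) ∂ν ≤
        ENNReal.ofReal (C * ε ^ α * δ⁻¹) * I := by
    have h1 : ∀ x : Space n, ∫⁻ h in ball (0 : Space n) ε, ∫⁻ t in Ioc (0 : ℝ) 1,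
        ENNReal.ofReal (t ^ (1 - δ)) * ‖fderiv ℝ φ (x + t • h)‖ₑ ^ 2 =
        ∫⁻ t in Ioc (0 : ℝ) 1, ENNReal.ofReal (t ^ (1 - δ)) *
          ∫⁻ h in ball (0 : Space n) ε, ‖fderiv ℝ φ (x + t • h)‖ₑ ^ 2 := by
      intro x
      rw [lintegral_lintegral_swap]
      · exact lintegral_congr fun t => lintegral_const_mul' _ _ ENNReal.ofReal_ne_top
      · have hx : Measurable fun q : Space n × ℝ => ((x, q.1), q.2) := by fun_prop
        exact (hM.comp hx).aemeasurable
    simp_rw [h1]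
    rw [lintegral_lintegral_swap]
    · have hmδ : Measurable fun t : ℝ => ENNReal.ofReal (t ^ (δ - 1)) := by fun_prop
      calc _ = ∫⁻ t in Ioc (0 : ℝ) 1, ENNReal.ofReal (t ^ (1 - δ)) * ∫⁻ x,
            (∫⁻ h in ball (0 : Space n) ε, ‖fderiv ℝ φ (x + t • h)‖ₑ ^ 2) ∂ν :=
            lintegral_congr fun t => lintegral_const_mul' _ _ ENNReal.ofReal_ne_top
        _ ≤ ∫⁻ t in Ioc (0 : ℝ) 1, ENNReal.ofReal (t ^ (δ - 1)) *
            (ENNReal.ofReal (C * ε ^ α) * I) := by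
            refine setLIntegral_mono' measurableSet_Ioc fun t ht => ?_
            refine (mul_le_mul_right (hball t ht) _).trans (le_of_eq ?_)
            have ht0 := ht.1
            rw [← mul_assoc, ← mul_assoc, ← mul_assoc, ← ENNReal.ofReal_mul (by positivity),
              ← ENNReal.ofReal_mul (by positivity), ← ENNReal.ofReal_mul (by positivity)]
            congr 2
            rw [Real.mul_rpow ht0.le hε.le, ← Real.rpow_natCast, ← Real.rpow_neg ht0.le]
            -- The only use of `α = n - 2 + 2δ`: the total power of `t` is `δ - 1 > -1`.
            have : t ^ (δ - 1) = t ^ (1 - δ) * t ^ (-(n : ℝ)) * t ^ α := by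
              rw [← Real.rpow_add ht0, ← Real.rpow_add ht0, hα]
              congr 1
              ring
            rw [this]
            ring
        _ = _ := by
            rw [lintegral_mul_const _ hmδ, lintegral_rpow_sub_one hδ, ← mul_assoc,
              ← ENNReal.ofReal_mul (by positivity), mul_comm δ⁻¹]
    · refine Measurable.aemeasurable ?_
      have h2 : Measurable fun p : (Space n × ℝ) × Space n =>
          ‖fderiv ℝ φ (p.1.1 + p.1.2 • p.2)‖ₑ ^ 2 :=
        (hcont.comp (by fun_prop)).enorm.measurable.pow_const 2
      have h3 := h2.lintegral_prod_right' (ν := volume.restrict (ball (0 : Space n) ε))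
      exact Measurable.mul (by fun_prop) h3
  have hval : ∫⁻ x, (∫⁻ h in ball (0 : Space n) ε, ‖φ (x + h)‖ₑ ^ 2) ∂ν ≤
      ENNReal.ofReal (C * ε ^ α) * ∫⁻ x, ‖φ x‖ₑ ^ 2 :=
    lintegral_ball_translate_le (fun x => hν x _ hε) hφ
  have hm1 : ∀ x : Space n, Measurable fun h : Space n => ‖φ (x + h)‖ₑ ^ 2 := fun x =>
    hφ.comp (measurable_const_add x)
  have hm2 : Measurable fun x : Space n => ∫⁻ h in ball (0 : Space n) ε, ‖φ (x + h)‖ₑ ^ 2 := by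
    have h2 : Measurable fun p : Space n × Space n => ‖φ (p.1 + p.2)‖ₑ ^ 2 := hφ.comp measurable_add
    exact h2.lintegral_prod_right' (ν := volume.restrict (ball (0 : Space n) ε))
  calc volume (ball (0 : Space n) ε) * ∫⁻ x, ‖φ x‖ₑ ^ 2 ∂ν
      = ∫⁻ x, (∫⁻ _ in ball (0 : Space n) ε, ‖φ x‖ₑ ^ 2) ∂ν := by
        simp_rw [lintegral_const, Measure.restrict_apply_univ]
        rw [lintegral_mul_const _ hφ, mul_comm]
    _ ≤ ∫⁻ x, (∫⁻ h in ball (0 : Space n) ε, (2 * ‖φ (x + h)‖ₑ ^ 2 +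
          2 * (ENNReal.ofReal (ε ^ 2 * δ⁻¹) * ∫⁻ t in Ioc (0 : ℝ) 1,
            ENNReal.ofReal (t ^ (1 - δ)) * ‖fderiv ℝ φ (x + t • h)‖ₑ ^ 2))) ∂ν := by
        refine lintegral_mono fun x => setLIntegral_mono' measurableSet_ball fun h hh => ?_
        exact enorm_sq_le_segment hδ φ x (mem_ball_zero_iff.1 hh).le
    _ = 2 * (∫⁻ x, (∫⁻ h in ball (0 : Space n) ε, ‖φ (x + h)‖ₑ ^ 2) ∂ν) +
        2 * (ENNReal.ofReal (ε ^ 2 * δ⁻¹) * ∫⁻ x, (∫⁻ h in ball (0 : Space n) ε,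
          ∫⁻ t in Ioc (0 : ℝ) 1,
            ENNReal.ofReal (t ^ (1 - δ)) * ‖fderiv ℝ φ (x + t • h)‖ₑ ^ 2) ∂ν) := by
        rw [← lintegral_const_mul' _ _ ENNReal.ofNat_ne_top,
          ← lintegral_const_mul' _ _ ENNReal.ofReal_ne_top,
          ← lintegral_const_mul' _ _ ENNReal.ofNat_ne_top, ← lintegral_add_left (hm2.const_mul 2)]
        refine lintegral_congr fun x => ?_
        rw [lintegral_add_left ((hm1 x).const_mul 2),
          lintegral_const_mul' _ _ ENNReal.ofNat_ne_top,
          lintegral_const_mul' _ _ ENNReal.ofNat_ne_top,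
          lintegral_const_mul' _ _ ENNReal.ofReal_ne_top]
    _ ≤ 2 * (ENNReal.ofReal (C * ε ^ α) * ∫⁻ x, ‖φ x‖ₑ ^ 2) +
        2 * (ENNReal.ofReal (ε ^ 2 * δ⁻¹) * (ENNReal.ofReal (C * ε ^ α * δ⁻¹) * I)) := by
        gcongr
    _ = _ := by
        rw [mul_assoc 2 C, ENNReal.ofReal_mul (p := 2) zero_le_two,
          ENNReal.ofReal_mul (p := 2 * (ε ^ 2 * δ⁻¹)) (by positivity),
          ENNReal.ofReal_mul (p := 2) zero_le_two, ENNReal.ofReal_ofNat]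
        ring

theorem norm_sq_le_sum_basisVec (L : Space n →L[ℝ] ℂ) : ‖L‖ ^ 2 ≤ ∑ i, ‖L (basisVec i)‖ ^ 2 := by
  have h : ‖L‖ ≤ √(∑ i, ‖L (basisVec i)‖ ^ 2) := by
    refine L.opNorm_le_bound (Real.sqrt_nonneg _) fun v => ?_
    have h1 : L v = ∑ i, (v i) • L (basisVec i) := by
      conv_lhs => rw [← (EuclideanSpace.basisFun (Fin n) ℝ).sum_repr v]
      simp [basisVec]
    have h2 : ‖L v‖ ≤ ∑ i, ‖L (basisVec i)‖ * ‖v i‖ := by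
      rw [h1]
      refine (norm_sum_le _ _).trans (le_of_eq ?_)
      simp only [norm_smul, mul_comm]
    refine h2.trans ((Real.sum_mul_le_sqrt_mul_sqrt _ _ _).trans (le_of_eq ?_))
    rw [EuclideanSpace.norm_eq v]
  calc ‖L‖ ^ 2 ≤ √(∑ i, ‖L (basisVec i)‖ ^ 2) ^ 2 := by gcongr
    _ = _ := Real.sq_sqrt (Finset.sum_nonneg fun i _ => by positivity)

theorem ofReal_norm_toLp_sq (ν : Measure (Space n)) [ν.HasTemperateGrowth] (φ : 𝓢(Space n, ℂ)) :
    ENNReal.ofReal (‖φ.toLp 2 ν‖ ^ 2) = ∫⁻ x, ‖φ x‖ₑ ^ 2 ∂ν := by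
  have h := eLpNorm_nnreal_pow_eq_lintegral (f := φ) (p := 2) (μ := ν) (by norm_num)
  rw [SchwartzMap.norm_toLp, ENNReal.ofReal_pow ENNReal.toReal_nonneg,
    ENNReal.ofReal_toReal (φ.memLp 2 ν).eLpNorm_ne_top]
  simpa using h

theorem lintegral_fderiv_sq_le (φ : 𝓢(Space n, ℂ)) :
    ∫⁻ x, ‖fderiv ℝ φ x‖ₑ ^ 2 ≤
      ENNReal.ofReal (∑ i : Fin n,
        ‖(∂_{basisVec i} φ : 𝓢(Space n, ℂ)).toLp 2 (volume : Measure (Space n))‖ ^ 2) := by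
  rw [ENNReal.ofReal_sum_of_nonneg fun i _ => by positivity]
  simp_rw [ofReal_norm_toLp_sq]
  rw [← lintegral_finsetSum _ fun i _ =>
    (∂_{basisVec i} φ : 𝓢(Space n, ℂ)).continuous.enorm.measurable.pow_const 2]
  refine lintegral_mono fun x => ?_
  have := ENNReal.ofReal_le_ofReal (norm_sq_le_sum_basisVec (fderiv ℝ φ x))
  rw [ENNReal.ofReal_sum_of_nonneg fun i _ => by positivity] at this
  simp_rw [ENNReal.ofReal_pow (norm_nonneg _), ofReal_norm] at this
  simpa only [SchwartzMap.lineDerivOp_apply_eq_fderiv] using this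

/-- A measure of dimension `α > n - 2` is form bounded with respect to `-Δ` on Schwartz functions,
with arbitrarily small relative bound. -/
theorem exists_norm_toLp_sq_le {ν : Measure (Space n)} [IsFiniteMeasure ν] {C α : ℝ}
    (hα : (n : ℝ) - 2 < α)
    (hν : ∀ x r, 0 < r → ν (ball x r) ≤ ENNReal.ofReal (C * r ^ α)) {a : ℝ} (ha : 0 < a) :
    ∃ b : ℝ, 0 ≤ b ∧ ∀ φ : 𝓢(Space n, ℂ), ‖φ.toLp 2 ν‖ ^ 2 ≤
      a * ∑ i : Fin n, ‖(∂_{basisVec i} φ : 𝓢(Space n, ℂ)).toLp 2 volume‖ ^ 2 +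
        b * ‖φ.toLp 2 volume‖ ^ 2 := by
  set δ := (α - (n - 2)) / 2 with hδ_def
  have hδ : 0 < δ := by linarith
  have hαδ : α = n - 2 + 2 * δ := by rw [hδ_def]; ring
  -- The given constant may be negative.
  set C' := max C 0
  have hC' : 0 ≤ C' := le_max_right _ _
  have hν' : ∀ x r, 0 < r → ν (ball x r) ≤ ENNReal.ofReal (C' * r ^ α) := fun x r hr =>
    (hν x r hr).trans (ENNReal.ofReal_le_ofReal (by gcongr; exact le_max_left _ _))
  set V := (volume (ball (0 : Space n) 1)).toReal with hV_def
  have hVtop : volume (ball (0 : Space n) 1) ≠ ∞ := measure_ball_lt_top.ne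
  have hV : 0 < V := ENNReal.toReal_pos (measure_ball_pos _ _ one_pos).ne' hVtop
  -- The left side is the gradient coefficient of `lintegral_enorm_sq_le` divided by the volume `ε^n
  -- V` of the ball.
  obtain ⟨ε, hεa, hε⟩ : ∃ ε : ℝ, 2 * C' * δ⁻¹ * δ⁻¹ * V⁻¹ * ε ^ (2 * δ) < a ∧ 0 < ε := by
    have hlim : Tendsto (fun ε : ℝ => 2 * C' * δ⁻¹ * δ⁻¹ * V⁻¹ * ε ^ (2 * δ)) (𝓝 0) (𝓝 0) := by
      have h : ContinuousAt (fun ε : ℝ => ε ^ (2 * δ)) 0 :=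
        Real.continuousAt_rpow_const _ _ (Or.inr (by linarith))
      have := h.tendsto.const_mul (2 * C' * δ⁻¹ * δ⁻¹ * V⁻¹)
      rwa [Real.zero_rpow (by linarith), mul_zero] at this
    have h1 := ((hlim.mono_left nhdsWithin_le_nhds).eventually (gt_mem_nhds ha)).and
      (self_mem_nhdsWithin (s := Ioi (0 : ℝ)))
    exact h1.exists
  refine ⟨2 * C' * ε ^ α * (ε ^ n * V)⁻¹, by positivity, fun φ => ?_⟩
  have hmain := lintegral_enorm_sq_le hC' hδ hαδ hε hν' φ
  set G := ∑ i : Fin n, ‖(∂_{basisVec i} φ : 𝓢(Space n, ℂ)).toLp 2 (volume : Measure (Space n))‖ ^ 2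
  have hG : 0 ≤ G := Finset.sum_nonneg fun i _ => by positivity
  have hvol : volume (ball (0 : Space n) ε) = ENNReal.ofReal (ε ^ n * V) := by
    rw [Measure.addHaar_ball_of_pos _ _ hε, finrank_euclideanSpace_fin,
      ENNReal.ofReal_mul (by positivity), hV_def, ENNReal.ofReal_toReal hVtop]
  have h2 := hmain.trans (add_le_add_right (mul_le_mul_right (lintegral_fderiv_sq_le φ) _) _)
  rw [← ofReal_norm_toLp_sq, ← ofReal_norm_toLp_sq, hvol, ← ENNReal.ofReal_mul (by positivity),
    ← ENNReal.ofReal_mul (by positivity), ← ENNReal.ofReal_mul (by positivity),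
    ← ENNReal.ofReal_add (by positivity) (by positivity),
    ENNReal.ofReal_le_ofReal_iff (by positivity)] at h2
  have hpos : 0 < ε ^ n * V := by positivity
  have hpow : ε ^ (2 * δ) * ε ^ n = ε ^ 2 * ε ^ α := by
    rw [← Real.rpow_natCast, ← Real.rpow_natCast, ← Real.rpow_add hε, ← Real.rpow_add hε, hαδ]
    congr 1
    push_cast
    ring
  have hcoef : 2 * (ε ^ 2 * δ⁻¹) * (C' * ε ^ α * δ⁻¹) ≤ a * (ε ^ n * V) := by
    calc 2 * (ε ^ 2 * δ⁻¹) * (C' * ε ^ α * δ⁻¹)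
        = 2 * C' * δ⁻¹ * δ⁻¹ * (ε ^ 2 * ε ^ α) := by ring
      _ = (2 * C' * δ⁻¹ * δ⁻¹ * V⁻¹ * ε ^ (2 * δ)) * (ε ^ n * V) := by
        rw [← hpow]
        field_simp
      _ ≤ _ := by gcongr
  rw [← mul_le_mul_iff_right₀ hpos]
  refine h2.trans ?_
  have : ε ^ n * V * (a * G + 2 * C' * ε ^ α * (ε ^ n * V)⁻¹ *
      ‖φ.toLp 2 (volume : Measure (Space n))‖ ^ 2) =
      2 * C' * ε ^ α * ‖φ.toLp 2 (volume : Measure (Space n))‖ ^ 2 + a * (ε ^ n * V) * G := by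
    field_simp
    ring
  rw [this]
  gcongr

end TraceInequality

/-! ### Traces of `H¹` functions and the form of `μ` -/

section Trace

variable {n : ℕ} {μ : SignedMeasure (Space n)}

/-- The total variation of `μ` is form bounded with respect to `-Δ` on Schwartz functions, with
arbitrarily small relative bound. -/
def IsFormBounded (μ : SignedMeasure (Space n)) : Prop :=
  ∀ a : ℝ, 0 < a → ∃ b : ℝ, 0 ≤ b ∧ ∀ φ : 𝓢(Space n, ℂ), ‖φ.toLp 2 μ.totalVariation‖ ^ 2 ≤
    a * ∑ i : Fin n, ‖(∂_{basisVec i} φ : 𝓢(Space n, ℂ)).toLp 2 volume‖ ^ 2 +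
      b * ‖φ.toLp 2 volume‖ ^ 2

theorem IsDimensional.isFormBounded {α : ℝ} (hα : (n : ℝ) - 2 < α) (h : IsDimensional α μ) :
    IsFormBounded μ := by
  obtain ⟨C, hC⟩ := h
  exact fun a ha => exists_norm_toLp_sq_le hα hC ha

theorem toLp_sub (ν : Measure (Space n)) [ν.HasTemperateGrowth] (φ ψ : 𝓢(Space n, ℂ)) :
    (φ - ψ).toLp 2 ν = φ.toLp 2 ν - ψ.toLp 2 ν :=
  map_sub (SchwartzMap.toLpCLM ℂ ℂ 2 ν) φ ψ

theorem toLp_add (ν : Measure (Space n)) [ν.HasTemperateGrowth] (φ ψ : 𝓢(Space n, ℂ)) :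
    (φ + ψ).toLp 2 ν = φ.toLp 2 ν + ψ.toLp 2 ν :=
  map_add (SchwartzMap.toLpCLM ℂ ℂ 2 ν) φ ψ

theorem toLp_smul (ν : Measure (Space n)) [ν.HasTemperateGrowth] (c : ℂ) (φ : 𝓢(Space n, ℂ)) :
    (c • φ).toLp 2 ν = c • φ.toLp 2 ν :=
  map_smul (SchwartzMap.toLpCLM ℂ ℂ 2 ν) c φ

theorem lineDeriv_sub (m : Space n) (φ ψ : 𝓢(Space n, ℂ)) :
    (∂_{m} (φ - ψ) : 𝓢(Space n, ℂ)) = ∂_{m} φ - ∂_{m} ψ :=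
  map_sub (LineDeriv.lineDerivOpCLM ℂ 𝓢(Space n, ℂ) m) φ ψ

/-- The form bound, applied to differences of an approximating sequence, makes its restrictions
Cauchy in `L²(|μ|)`. -/
theorem exists_isTrace (hμ : IsFormBounded μ) (u : H1 n) : ∃ f, IsTrace μ u f := by
  obtain ⟨φ, h0, h1⟩ := exists_schwartz_tendsto u
  obtain ⟨b, -, hb⟩ := hμ 1 one_pos
  have hcau : CauchySeq fun k => (φ k).toLp 2 μ.totalVariation := by
    rw [cauchySeq_iff_tendsto_dist_atTop_0]
    have h0' := cauchySeq_iff_tendsto_dist_atTop_0.1 h0.cauchySeq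
    have h1' := fun i => cauchySeq_iff_tendsto_dist_atTop_0.1 (h1 i).cauchySeq
    have hlim := ((tendsto_finsetSum Finset.univ fun i _ => (h1' i).pow 2).const_mul 1).add
      ((h0'.pow 2).const_mul b)
    have h3 : Tendsto (fun p : ℕ × ℕ => dist ((φ p.1).toLp 2 μ.totalVariation)
        ((φ p.2).toLp 2 μ.totalVariation) ^ 2) atTop (𝓝 0) := by
      refine squeeze_zero (fun _ => by positivity) (fun p => ?_) (by simpa using hlim)
      have := hb (φ p.1 - φ p.2)
      simp only [toLp_sub, lineDeriv_sub] at this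
      simpa only [dist_eq_norm, one_mul] using this
    simpa [Real.sqrt_sq dist_nonneg] using h3.sqrt
  obtain ⟨f, hf⟩ := cauchySeq_tendsto_of_complete hcau
  exact ⟨f, φ, h0, h1, hf⟩

theorem IsTrace.norm_sq_le {a b : ℝ} (hab : ∀ φ : 𝓢(Space n, ℂ),
    ‖φ.toLp 2 μ.totalVariation‖ ^ 2 ≤
      a * ∑ i : Fin n, ‖(∂_{basisVec i} φ : 𝓢(Space n, ℂ)).toLp 2 volume‖ ^ 2 +
        b * ‖φ.toLp 2 volume‖ ^ 2) {u : H1 n} {f : Lp ℂ 2 μ.totalVariation} (h : IsTrace μ u f) :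
    ‖f‖ ^ 2 ≤ a * ∑ i, ‖weakPartial i u‖ ^ 2 + b * ‖(u : L2 n)‖ ^ 2 := by
  obtain ⟨φ, h0, h1, h2⟩ := h
  exact le_of_tendsto_of_tendsto' (h2.norm.pow 2)
    (((tendsto_finsetSum Finset.univ fun i _ => (h1 i).norm.pow 2).const_mul a).add
      ((h0.norm.pow 2).const_mul b)) fun k => hab (φ k)

theorem IsTrace.add {u v : H1 n} {f g : Lp ℂ 2 μ.totalVariation} (hf : IsTrace μ u f)
    (hg : IsTrace μ v g) : IsTrace μ (u + v) (f + g) := by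
  obtain ⟨φ, h0, h1, h2⟩ := hf
  obtain ⟨ψ, k0, k1, k2⟩ := hg
  refine ⟨fun k => φ k + ψ k, ?_, fun i => ?_, ?_⟩
  · simpa only [toLp_add, Submodule.coe_add] using h0.add k0
  · simpa only [LineDeriv.lineDerivOp_add, toLp_add, weakPartial_add] using (h1 i).add (k1 i)
  · simpa only [toLp_add] using h2.add k2

theorem IsTrace.smul (c : ℂ) {u : H1 n} {f : Lp ℂ 2 μ.totalVariation} (hf : IsTrace μ u f) :
    IsTrace μ (c • u) (c • f) := by
  obtain ⟨φ, h0, h1, h2⟩ := hf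
  refine ⟨fun k => c • φ k, ?_, fun i => ?_, ?_⟩
  · simpa only [toLp_smul, Submodule.coe_smul] using h0.const_smul c
  · simpa only [LineDeriv.lineDerivOp_smul, toLp_smul, weakPartial_smul] using (h1 i).const_smul c
  · simpa only [toLp_smul] using h2.const_smul c

/-- The difference of two traces is a trace of `0`, so the norm bound makes it vanish. -/
theorem IsTrace.unique (hμ : IsFormBounded μ) {u : H1 n} {f g : Lp ℂ 2 μ.totalVariation}
    (hf : IsTrace μ u f) (hg : IsTrace μ u g) : f = g := by
  obtain ⟨b, -, hb⟩ := hμ 1 one_pos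
  have h := (hf.add (hg.smul (-1))).norm_sq_le hb
  have h0 : u + (-1 : ℂ) • u = 0 := by module
  have hw : ∀ i, weakPartial i (0 : H1 n) = 0 := fun i => by simpa using weakPartial_smul i 0 0
  rw [h0] at h
  simp only [hw, Submodule.coe_zero, norm_zero] at h
  have h1 : ‖f + (-1 : ℂ) • g‖ = 0 := by
    have : ‖f + (-1 : ℂ) • g‖ ^ 2 ≤ 0 := by simpa using h
    exact pow_eq_zero_iff two_ne_zero |>.1 (le_antisymm this (sq_nonneg _))
  rw [norm_eq_zero, neg_one_smul] at h1
  exact eq_of_sub_eq_zero (by rwa [sub_eq_add_neg])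

theorem isTrace_trace (hμ : IsFormBounded μ) (u : H1 n) : IsTrace μ u (trace μ u) := by
  have h := exists_isTrace hμ u
  rw [trace, dif_pos h]
  exact h.choose_spec

theorem trace_eq (hμ : IsFormBounded μ) {u : H1 n} {f : Lp ℂ 2 μ.totalVariation}
    (h : IsTrace μ u f) : trace μ u = f :=
  (isTrace_trace hμ u).unique hμ h

theorem trace_toLp (hμ : IsFormBounded μ) (φ : 𝓢(Space n, ℂ)) :
    trace μ ⟨φ.toLp 2 volume, toLp_mem_H1 φ⟩ = φ.toLp 2 μ.totalVariation := by
  refine trace_eq hμ ⟨fun _ => φ, tendsto_const_nhds, fun i => ?_, tendsto_const_nhds⟩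
  rw [weakPartial_toLp]
  exact tendsto_const_nhds

/-- The trace on `μ`, as a linear map. -/
noncomputable def traceLinearMap (hμ : IsFormBounded μ) : H1 n →ₗ[ℂ] Lp ℂ 2 μ.totalVariation where
  toFun := trace μ
  map_add' u v := trace_eq hμ ((isTrace_trace hμ u).add (isTrace_trace hμ v))
  map_smul' c u := trace_eq hμ ((isTrace_trace hμ u).smul c)

/-- The map `L²(ν) → L²(ν')` for `ν' ≤ ν`. -/
noncomputable def lpOfMeasureLE {ν ν' : Measure (Space n)} (h : ν' ≤ ν) :
    Lp ℂ 2 ν →L[ℂ] Lp ℂ 2 ν' :=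
  LinearMap.mkContinuous
    { toFun := fun f => ((Lp.memLp f).mono_measure h).toLp f
      map_add' := fun f g => by
        rw [← MemLp.toLp_add]
        exact MemLp.toLp_congr _ _ ((Measure.absolutelyContinuous_of_le h).ae_le
          (Lp.coeFn_add f g))
      map_smul' := fun c f => by
        rw [RingHom.id_apply, ← MemLp.toLp_const_smul]
        exact MemLp.toLp_congr _ _ ((Measure.absolutelyContinuous_of_le h).ae_le
          (Lp.coeFn_smul c f)) } 1 fun f => by
    rw [one_mul, LinearMap.coe_mk, AddHom.coe_mk, Lp.norm_toLp, Lp.norm_def]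
    exact ENNReal.toReal_mono (Lp.eLpNorm_ne_top f) (eLpNorm_mono_measure _ h)

theorem coeFn_lpOfMeasureLE {ν ν' : Measure (Space n)} (h : ν' ≤ ν) (f : Lp ℂ 2 ν) :
    lpOfMeasureLE h f =ᵐ[ν'] f :=
  MemLp.coeFn_toLp ((Lp.memLp f).mono_measure h)

theorem norm_lpOfMeasureLE_le {ν ν' : Measure (Space n)} (h : ν' ≤ ν) (f : Lp ℂ 2 ν) :
    ‖lpOfMeasureLE h f‖ ≤ ‖f‖ := by
  simpa using (lpOfMeasureLE h).le_of_opNorm_le (LinearMap.mkContinuous_norm_le _ zero_le_one _) f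

theorem posPart_le_totalVariation (μ : SignedMeasure (Space n)) :
    μ.toJordanDecomposition.posPart ≤ μ.totalVariation :=
  Measure.le_add_right le_rfl

theorem negPart_le_totalVariation (μ : SignedMeasure (Space n)) :
    μ.toJordanDecomposition.negPart ≤ μ.totalVariation :=
  Measure.le_add_left le_rfl

theorem inner_lpOfMeasureLE {ν ν' : Measure (Space n)} (h : ν' ≤ ν) (f g : Lp ℂ 2 ν) :
    inner ℂ (lpOfMeasureLE h f) (lpOfMeasureLE h g) = ∫ x, star (f x) * g x ∂ν' := by
  rw [L2.inner_def]
  refine integral_congr_ae ?_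
  filter_upwards [coeFn_lpOfMeasureLE h f, coeFn_lpOfMeasureLE h g] with x hf hg
  rw [hf, hg, RCLike.inner_apply, mul_comm]
  rfl

/-- As a difference of inner products the form is visibly continuous, and it is later represented
through adjoints. -/
theorem signedIntegral_star_mul (f g : Lp ℂ 2 μ.totalVariation) :
    signedIntegral μ (fun x => star (f x) * g x) =
      inner ℂ (lpOfMeasureLE (posPart_le_totalVariation μ) f)
        (lpOfMeasureLE (posPart_le_totalVariation μ) g) -
      inner ℂ (lpOfMeasureLE (negPart_le_totalVariation μ) f)
        (lpOfMeasureLE (negPart_le_totalVariation μ) g) := by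
  rw [inner_lpOfMeasureLE, inner_lpOfMeasureLE, signedIntegral]

theorem signedIntegral_congr_ae {f g : Space n → ℂ} (h : f =ᵐ[μ.totalVariation] g) :
    signedIntegral μ f = signedIntegral μ g := by
  rw [signedIntegral, signedIntegral,
    integral_congr_ae ((Measure.absolutelyContinuous_of_le (posPart_le_totalVariation μ)).ae_le h),
    integral_congr_ae ((Measure.absolutelyContinuous_of_le (negPart_le_totalVariation μ)).ae_le h)]

/-- The integral is a difference of two numbers in `[0, ‖f‖²]`. -/
theorem norm_signedIntegral_star_mul_self_le (f : Lp ℂ 2 μ.totalVariation) :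
    ‖signedIntegral μ fun x => star (f x) * f x‖ ≤ ‖f‖ ^ 2 := by
  rw [signedIntegral_star_mul, inner_self_eq_norm_sq_to_K, inner_self_eq_norm_sq_to_K]
  have h1 := norm_lpOfMeasureLE_le (posPart_le_totalVariation μ) f
  have h2 := norm_lpOfMeasureLE_le (negPart_le_totalVariation μ) f
  set x := ‖lpOfMeasureLE (posPart_le_totalVariation μ) f‖
  set y := ‖lpOfMeasureLE (negPart_le_totalVariation μ) f‖
  have hx : 0 ≤ x := norm_nonneg _
  have hy : 0 ≤ y := norm_nonneg _
  have h3 : ((x : ℂ) ^ 2 - (y : ℂ) ^ 2) = ((x ^ 2 - y ^ 2 : ℝ) : ℂ) := by push_cast; rfl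
  refine (congrArg norm h3).trans_le ?_
  rw [Complex.norm_real, Real.norm_eq_abs, abs_le]
  constructor <;> nlinarith

theorem dirichletForm_self_re (u : H1 n) :
    (dirichletForm u u).re = ∑ i, ‖weakPartial i u‖ ^ 2 := by
  rw [dirichletForm, Complex.re_sum]
  exact Finset.sum_congr rfl fun i _ => inner_self_eq_norm_sq (𝕜 := ℂ) _

theorem norm_measureForm_le (hμ : IsFormBounded μ) {a : ℝ} (ha : 0 < a) :
    ∃ b : ℝ, 0 ≤ b ∧ ∀ u : H1 n,
      ‖measureForm μ u u‖ ≤ a * (dirichletForm u u).re + b * ‖(u : L2 n)‖ ^ 2 := by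
  obtain ⟨b, hb0, hb⟩ := hμ a ha
  refine ⟨b, hb0, fun u => (norm_signedIntegral_star_mul_self_le _).trans ?_⟩
  rw [dirichletForm_self_re]
  exact (isTrace_trace hμ u).norm_sq_le hb

end Trace

/-! ### Equivalence of the distributional and the form equation -/

section WeakFormulation

variable {n : ℕ} {μ : SignedMeasure (Space n)}

/-- The complex conjugate of a Schwartz function. -/
noncomputable def conjSchwartz (φ : 𝓢(Space n, ℂ)) : 𝓢(Space n, ℂ) :=
  SchwartzMap.postcompCLM (Complex.conjCLE : ℂ →L[ℝ] ℂ) φ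

theorem conjSchwartz_apply (φ : 𝓢(Space n, ℂ)) (x : Space n) :
    conjSchwartz φ x = star (φ x) := rfl

theorem conjSchwartz_conjSchwartz (φ : 𝓢(Space n, ℂ)) : conjSchwartz (conjSchwartz φ) = φ := by
  ext x
  simp [conjSchwartz_apply]

theorem lineDeriv_conjSchwartz (m : Space n) (φ : 𝓢(Space n, ℂ)) :
    (∂_{m} (conjSchwartz φ) : 𝓢(Space n, ℂ)) = conjSchwartz (∂_{m} φ) := by
  ext x
  rw [conjSchwartz_apply, SchwartzMap.lineDerivOp_apply_eq_fderiv,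
    SchwartzMap.lineDerivOp_apply_eq_fderiv]
  have h : HasFDerivAt (conjSchwartz φ) ((Complex.conjCLE : ℂ →L[ℝ] ℂ) ∘L fderiv ℝ φ x) x :=
    (Complex.conjCLE : ℂ →L[ℝ] ℂ).hasFDerivAt.comp x (φ.differentiable x).hasFDerivAt
  rw [h.fderiv]
  rfl

/-- Conjugation reconciles the bilinear pairing of distributions with the inner product,
conjugate-linear in its first slot. -/
theorem inner_conjSchwartz (φ : 𝓢(Space n, ℂ)) (f : L2 n) :
    inner ℂ ((conjSchwartz φ).toLp 2 volume) f = (f : 𝓢'(Space n, ℂ)) φ := by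
  rw [L2.inner_def, Lp.toTemperedDistribution_apply]
  refine integral_congr_ae ?_
  filter_upwards [(conjSchwartz φ).coeFn_toLp 2 volume] with x hx
  rw [hx, RCLike.inner_apply, conjSchwartz_apply, smul_eq_mul, mul_comm]
  simp

theorem dirichletForm_conjSchwartz (φ : 𝓢(Space n, ℂ)) (u : H1 n) :
    dirichletForm ⟨(conjSchwartz φ).toLp 2 volume, toLp_mem_H1 _⟩ u =
      -(Δ ((u : L2 n) : 𝓢'(Space n, ℂ))) φ := by
  have hΔ : Δ ((u : L2 n) : 𝓢'(Space n, ℂ)) =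
      ∑ i : Fin n, ∂_{basisVec i} (∂_{basisVec i} ((u : L2 n) : 𝓢'(Space n, ℂ))) := by
    rw [TemperedDistribution.laplacian_eq_sum (EuclideanSpace.basisFun (Fin n) ℝ)]
    simp [basisVec]
  rw [hΔ, dirichletForm, _root_.sum_apply, ← Finset.sum_neg_distrib]
  refine Finset.sum_congr rfl fun i _ => ?_
  rw [weakPartial_toLp, lineDeriv_conjSchwartz, inner_conjSchwartz, coe_weakPartial,
    TemperedDistribution.lineDerivOp_apply_apply (∂_{basisVec i} ((u : L2 n) : 𝓢'(Space n, ℂ)))]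
  simp [integral_neg]

theorem measureForm_conjSchwartz (hμ : IsFormBounded μ) (φ : 𝓢(Space n, ℂ)) (u : H1 n) :
    measureForm μ ⟨(conjSchwartz φ).toLp 2 volume, toLp_mem_H1 _⟩ u =
      signedIntegral μ fun x => φ x * trace μ u x := by
  rw [measureForm, trace_toLp hμ]
  refine signedIntegral_congr_ae ?_
  filter_upwards [(conjSchwartz φ).coeFn_toLp 2 μ.totalVariation] with x hx
  rw [hx, conjSchwartz_apply, star_star]

/-- The operator `-Δ + μ`, in the sense of distributions, is given by its form. -/
theorem actsTo_iff (hμ : IsFormBounded μ) (u f : L2 n) :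
    ActsTo μ u f ↔ ∃ hu : u ∈ H1 n, ∀ v : H1 n,
      inner ℂ (v : L2 n) f = schrodingerForm μ v ⟨u, hu⟩ := by
  refine exists_congr fun hu => ⟨fun h v => ?_, fun h φ => ?_⟩
  -- The sequence that defines the trace of `v` converges at once in `L²`, in the gradients and in
  -- `L²(|μ|)`, so every term of the identity passes to the limit.
  · obtain ⟨φ, h0, h1, h2⟩ := isTrace_trace hμ v
    have hφ : ∀ k, inner ℂ ((φ k).toLp 2 volume) f =
        schrodingerForm μ ⟨(φ k).toLp 2 volume, toLp_mem_H1 _⟩ ⟨u, hu⟩ := by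
      intro k
      have := h (conjSchwartz (φ k))
      rw [← measureForm_conjSchwartz hμ, ← inner_conjSchwartz,
        ← dirichletForm_conjSchwartz _ ⟨u, hu⟩] at this
      simp only [conjSchwartz_conjSchwartz] at this
      exact this
    refine tendsto_nhds_unique (h0.inner tendsto_const_nhds) ?_
    simp only [hφ, schrodingerForm, dirichletForm, measureForm, signedIntegral_star_mul,
      weakPartial_toLp, trace_toLp hμ]
    refine (tendsto_finsetSum _ fun i _ => (h1 i).inner tendsto_const_nhds).add
      (Tendsto.sub ?_ ?_)
    · exact (((lpOfMeasureLE (posPart_le_totalVariation μ)).continuous.tendsto _).comp h2).inner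
        tendsto_const_nhds
    · exact (((lpOfMeasureLE (negPart_le_totalVariation μ)).continuous.tendsto _).comp h2).inner
        tendsto_const_nhds
  · rw [← inner_conjSchwartz, ← dirichletForm_conjSchwartz _ ⟨u, hu⟩,
      ← measureForm_conjSchwartz hμ]
    exact h ⟨_, toLp_mem_H1 _⟩

end WeakFormulation

/-! ### The self-adjoint realization of `-Δ + μ` -/

section Operator

variable {n : ℕ} {μ : SignedMeasure (Space n)}

/-- There is a self-adjoint operator whose graph is that of `-Δ + μ`; it is bounded from below and
has form domain `H¹`. -/
theorem exists_isSelfAdjoint_actsTo (hμ : IsFormBounded μ) :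
    ∃ H : L2 n →ₗ.[ℂ] L2 n, IsSelfAdjoint H ∧ (∀ u f, (u, f) ∈ H.graph ↔ ActsTo μ u f) ∧
      IsBoundedBelow H ∧ formDomain H = (H1 n : Set (L2 n)) := by
  obtain ⟨J, D, K, hinj, hran, hD, ⟨hK, hnorm⟩, -⟩ := exists_besselPotential n
  have hmem : ∀ g, J g ∈ H1 n := fun g => (hran _).2 ⟨g, rfl⟩
  obtain ⟨b, hb0, hb⟩ := norm_measureForm_le hμ (a := 1 / 2) (by norm_num)
  have hdir : ∀ g g', dirichletForm (⟨J g', hmem g'⟩ : H1 n) ⟨J g, hmem g⟩ =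
      ∑ i, inner ℂ (D i g') (D i g) := by
    intro g g'
    simp only [dirichletForm, hD]
  obtain ⟨T, hT⟩ : ∃ T : L2 n →L[ℂ] Lp ℂ 2 μ.totalVariation,
      ∀ g, T g = trace μ ⟨J g, hmem g⟩ := by
    let T₀ : L2 n →ₗ[ℂ] Lp ℂ 2 μ.totalVariation :=
      (traceLinearMap hμ).comp ((J : L2 n →ₗ[ℂ] L2 n).codRestrict (H1 n) hmem)
    obtain ⟨b, hb0, hb⟩ := hμ 1 one_pos
    refine ⟨T₀.mkContinuous (√(∑ i, ‖D i‖ ^ 2 + b * ‖J‖ ^ 2)) fun g => ?_, fun g => rfl⟩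
    have h1 : ‖trace μ ⟨J g, hmem g⟩‖ ^ 2 ≤ (∑ i, ‖D i‖ ^ 2 + b * ‖J‖ ^ 2) * ‖g‖ ^ 2 := by
      refine ((isTrace_trace hμ ⟨J g, hmem g⟩).norm_sq_le hb).trans ?_
      simp only [hD, one_mul]
      rw [add_mul, Finset.sum_mul, mul_assoc]
      gcongr with i
      · rw [← mul_pow]
        gcongr
        exact (D i).le_opNorm g
      · rw [← mul_pow]
        gcongr
        exact J.le_opNorm g
    have h2 := Real.sqrt_le_sqrt h1
    rw [Real.sqrt_sq (norm_nonneg _), Real.sqrt_mul (by positivity),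
      Real.sqrt_sq (norm_nonneg _)] at h2
    exact h2
  set P := lpOfMeasureLE (posPart_le_totalVariation μ) ∘L T with hP
  set N := lpOfMeasureLE (negPart_le_totalVariation μ) ∘L T with hN
  have hmf : ∀ g g', measureForm μ ⟨J g', hmem g'⟩ ⟨J g, hmem g⟩ =
      inner ℂ (P g') (P g) - inner ℂ (N g') (N g) := by
    intro g g'
    rw [measureForm, signedIntegral_star_mul, ← hT, ← hT]
    rfl
  -- The form pulled back by `J` and shifted by `b + 1/2`: relative bound `1/2` keeps half of the
  -- Dirichlet form, `b` absorbs the `L²` error, and `1/2` leaves half of `‖J g‖²`.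
  let B : L2 n →L[ℂ] L2 n := ∑ i, (D i).adjoint ∘L D i + (P.adjoint ∘L P - N.adjoint ∘L N) +
    ((b + 1 / 2 : ℝ) : ℂ) • (J.adjoint ∘L J)
  have hB : ∀ g g', inner ℂ g' (B g) =
      schrodingerForm μ ⟨J g', hmem g'⟩ ⟨J g, hmem g⟩ +
        ((b + 1 / 2 : ℝ) : ℂ) * inner ℂ (J g') (J g) := by
    intro g g'
    rw [schrodingerForm, hdir, hmf]
    simp only [B, add_apply, sum_apply, sub_apply, smul_apply, ContinuousLinearMap.comp_apply,
      inner_add_right, inner_sub_right, inner_sum, inner_smul_right,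
      ContinuousLinearMap.adjoint_inner_right]
  have hBs : IsSelfAdjoint B := by
    have hAA : ∀ {F : Type} [NormedAddCommGroup F] [InnerProductSpace ℂ F] [CompleteSpace F]
        (A : L2 n →L[ℂ] F), IsSelfAdjoint (A.adjoint ∘L A) := by
      intro F _ _ _ A
      rw [ContinuousLinearMap.isSelfAdjoint_iff_isSymmetric]
      intro x y
      change inner ℂ (A.adjoint (A x)) y = inner ℂ x (A.adjoint (A y))
      rw [ContinuousLinearMap.adjoint_inner_left, ContinuousLinearMap.adjoint_inner_right]
    refine ((isSelfAdjoint_sum _ fun i _ => hAA (D i)).add ((hAA P).sub (hAA N))).add ?_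
    exact IsSelfAdjoint.smul (Complex.conj_ofReal _) (hAA J)
  -- The factor `2` comes from the remaining halves, `K²` from the norm equivalence, and `n + 1`
  -- from Cauchy–Schwarz on a sum of `n + 1` norms.
  have hcoer : ∀ g, (2 * K ^ 2 * (n + 1))⁻¹ * ‖g‖ ^ 2 ≤ (inner ℂ g (B g)).re := by
    intro g
    have h1 := hb ⟨J g, hmem g⟩
    have h2 := (abs_le.1 ((Complex.abs_re_le_norm _).trans h1)).1
    rw [hB, schrodingerForm, Complex.add_re, Complex.add_re, inner_self_eq_norm_sq_to_K]
    have h3 : (((b + 1 / 2 : ℝ) : ℂ) * ((‖J g‖ : ℝ) : ℂ) ^ 2).re = (b + 1 / 2) * ‖J g‖ ^ 2 := by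
      rw [← Complex.ofReal_pow, ← Complex.ofReal_mul, Complex.ofReal_re]
    refine le_trans ?_ (add_le_add (add_le_add_right h2 _) h3.ge)
    rw [dirichletForm_self_re]
    simp only [hD]
    have h4 : (‖J g‖ + ∑ i, ‖D i g‖) ^ 2 ≤ (n + 1) * (‖J g‖ ^ 2 + ∑ i, ‖D i g‖ ^ 2) := by
      have := sq_sum_le_card_mul_sum_sq (s := (Finset.univ : Finset (Option (Fin n))))
        (f := fun o => o.elim ‖J g‖ fun i => ‖D i g‖)
      simpa [Fintype.sum_option] using this
    have h5 : ‖g‖ ^ 2 ≤ K ^ 2 * ((n + 1) * (‖J g‖ ^ 2 + ∑ i, ‖D i g‖ ^ 2)) := by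
      refine (pow_le_pow_left₀ (norm_nonneg _) (hnorm g) 2).trans ?_
      rw [mul_pow]
      gcongr
    rw [inv_mul_le_iff₀ (by positivity)]
    refine h5.trans (le_of_eq ?_)
    ring
  have hJd : DenseRange J := by
    refine (SchwartzMap.denseRange_toLpCLM (E := Space n) (F := ℂ) (p := 2)
      (μ := volume) ENNReal.ofNat_ne_top).mono ?_
    rintro _ ⟨φ, rfl⟩
    exact (hran _).1 (toLp_mem_H1 φ)
  obtain ⟨H, hHs, hHg, hHb, hHf⟩ := exists_isSelfAdjoint_of_form hinj hJd hBs
    (by positivity) hcoer (b + 1 / 2)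
  refine ⟨H, hHs, fun u f => ?_, hHb, ?_⟩
  · rw [hHg, actsTo_iff hμ]
    constructor
    · rintro ⟨g, rfl, hg⟩
      refine ⟨hmem g, ?_⟩
      rintro ⟨v, hv⟩
      obtain ⟨g', rfl⟩ := (hran v).1 hv
      have := hg g'
      rw [hB, inner_add_right, inner_smul_right] at this
      exact (add_right_cancel this).symm
    · rintro ⟨hu, h⟩
      obtain ⟨g, rfl⟩ := (hran u).1 hu
      refine ⟨g, rfl, fun g' => ?_⟩
      rw [hB, inner_add_right, inner_smul_right, ← h ⟨J g', hmem g'⟩]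
  · rw [hHf]
    ext u
    exact (hran u).symm

end Operator

end MeasureSchrodinger

/-! ### The main theorem -/

open MeasureSchrodinger in
theorem proposition2p1 (n : ℕ) (hn : 3 ≤ n) (α : ℝ) (hα : (n : ℝ) - 2 < α)
    (μ : MeasureTheory.SignedMeasure (Space n))
    (hμ : CompactlySupported μ) (hμα : IsDimensional α μ) :
    -- every element of `H¹` has a unique trace on `μ`, so that the forms below are meaningful
    (∀ u : H1 n, ∃! f, IsTrace μ u f) ∧
    -- `μ` is form-bounded relative to `-Δ` with arbitrarily small relative bound
    (∀ a : ℝ, 0 < a → ∃ b : ℝ, ∀ u : H1 n,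
      ‖measureForm μ u u‖ ≤ a * (dirichletForm u u).re + b * ‖(u : L2 n)‖ ^ 2) ∧
    -- there is exactly one self-adjoint extension of `-Δ + μ`; it is bounded from below, has form
    -- domain `H¹` and acts as `-Δ + μ`, and it is the only self-adjoint operator of that form
    ∃ H : L2 n →ₗ.[ℂ] L2 n,
      (IsSelfAdjoint H ∧ Extends μ H ∧ ∀ u : H.domain, ActsTo μ u (H u)) ∧
      (IsBoundedBelow H ∧ formDomain H = (H1 n : Set (L2 n)) ∧ IsAssociated μ H) ∧
      (∀ H' : L2 n →ₗ.[ℂ] L2 n, IsSelfAdjoint H' → Extends μ H' → H' = H) ∧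
      ∀ H' : L2 n →ₗ.[ℂ] L2 n, IsSelfAdjoint H' → IsAssociated μ H' → H' = H := by
  have hb := hμα.isFormBounded hα
  obtain ⟨H, hHs, hHg, hHb, hHf⟩ := exists_isSelfAdjoint_actsTo hb
  have hacts : ∀ u : H.domain, ActsTo μ u (H u) := fun u => (hHg _ _).1 (H.mem_graph u)
  refine ⟨fun u => ⟨trace μ u, isTrace_trace hb u, fun f hf => (trace_eq hb hf).symm⟩,
    fun a ha => (norm_measureForm_le hb ha).imp fun _ h => h.2, H,
    ⟨hHs, fun u f h => (hHg u f).2 h, hacts⟩,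
    ⟨hHb, hHf, fun u => (actsTo_iff hb _ _).1 (hacts u)⟩, fun H' hH's hext => ?_,
    fun H' hH's hass => ?_⟩
  -- The graph of `H` is that of `-Δ + μ`, so any extension of the latter extends `H`.
  · refine eq_of_isSelfAdjoint_of_le hHs hH's (LinearPMap.le_of_le_graph ?_)
    rintro ⟨u, f⟩ h
    exact hext u f ((hHg u f).1 h)
  -- Here the inclusion is reversed: by `actsTo_iff`, an operator associated with the form is a
  -- restriction of `H`.
  · refine (eq_of_isSelfAdjoint_of_le hH's hHs (LinearPMap.le_of_le_graph ?_)).symm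
    rintro ⟨u, f⟩ h
    obtain ⟨x, hx, hxf⟩ := LinearPMap.mem_graph_iff _ |>.1 h
    rw [hHg, actsTo_iff hb]
    simpa only [hx, hxf] using hass x
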